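/- Let $d\ge 1$ and let $Z(t)$, $t\in\mathbb{R}^d$, be a non-negative random field on a probability space $(\Omega,\mathcal F,\mathbb P)$ such that $\mathbb{E}[Z(t)]=1$ for all $t\in\mathbb{R}^d$ and $\mathbb{E}\big[\sup_{t\in[0,T]^d}Z(t)\big]<\infty$ for all $T>0$. Suppose that $Z$ is a spectral random field of a stationary max-stable random field, that is, the random field $$X(t)=\max_{i\ge 1}\Gamma_i^{-1}Z^{(i)}(t),\qquad t\in\mathbb{R}^d,$$ is stationary (its finite-dimensional distributions are invariant under shifts of $\mathbb{R}^d$), where $\Gamma_i=\mathcal V_1+\dots+\mathcal V_i$ with $\mathcal V_1,\mathcal V_2,\dots$ independent unit exponential random variables, independent of the independent copies $Z^{(1)},Z^{(2)},\dots$ of $Z$. For $x\ge 0$ let $$\mathcal{B}_Z^0(x)=\lim_{T\to\infty}\frac1{T^d}\int_0^\infty \mathbb{P}\Big\{\int_{[0,T]^d}\mathbb{I}(Z(t)>s)\,dt>x\Big\}\,ds .$$ If $Z$ has almost surely continuous trajectories, then this limit exists and is finite for every $x\ge 0$, and $x\mapsto \mathcal{B}_Z^0(x)$ is continuous on $[0,\infty)$,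 i.e. $\lim_{x\to x_0}\mathcal{B}_Z^0(x)=\mathcal{B}_Z^0(x_0)$ for all $x_0\ge 0$ (with $x\to x_0$ within $[0,\infty)$). -/

import Mathlib

open MeasureTheory ProbabilityTheory Filter Topology
open scoped ENNReal

noncomputable section

namespace Berman

variable {Ω : Type*} {d : ℕ}

/-- The probability space carrying the points `Γ_i` and the independent copies `Z^{(i)}`:
a sample is a pair `(v, ω)` where `v k` are i.i.d. unit exponential, `ω i` are i.i.d. with law `P`,
and the two sequences are independent. -/
def deHaanMeasure [MeasurableSpace Ω] (P : Measure Ω) [IsProbabilityMeasure P] :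
    Measure ((ℕ → ℝ) × (ℕ → Ω)) :=
  (Measure.infinitePi (fun _ : ℕ => expMeasure 1)).prod (Measure.infinitePi (fun _ : ℕ => P))

/-- The arrival times `Γ_i` (indexed from `i = 0`): partial sums of the exponential variables. -/
def arrival (i : ℕ) (v : ℕ → ℝ) : ℝ := ∑ k ∈ Finset.range (i + 1), v k

/-- The max-stable random field with spectral random field `Z`:
`X(t) = sup_i Γ_i⁻¹ Z^{(i)}(t)`, where `Z^{(i)}(t)(ω) = Z(t)(ω_i)`. -/
def maxStableField (Z : (Fin d → ℝ) → Ω → ℝ) (t : Fin d → ℝ) (w : (ℕ → ℝ) × (ℕ → Ω)) : ℝ≥0∞ :=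
  ⨆ i : ℕ, ENNReal.ofReal ((arrival i w.1)⁻¹ * Z t (w.2 i))

/-- Stationarity of a random field: its finite-dimensional distributions are shift-invariant. -/
def IsStationaryField {Ω' S : Type*} [MeasurableSpace Ω'] [MeasurableSpace S] (μ : Measure Ω')
    (X : (Fin d → ℝ) → Ω' → S) : Prop :=
  ∀ (h : Fin d → ℝ) (n : ℕ) (t : Fin n → (Fin d → ℝ)),
    IdentDistrib (fun w j => X (t j + h) w) (fun w j => X (t j) w) μ μ

/-- The cube `[0,T]^d`. -/
def cube (d : ℕ) (T : ℝ) : Set (Fin d → ℝ) := Set.Icc 0 (fun _ => T)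

/-- `∫_{[0,T]^d} 𝕀(Z(t) > s) dt`. -/
def sojourn (Z : (Fin d → ℝ) → Ω → ℝ) (T s : ℝ) (ω : Ω) : ℝ≥0∞ :=
  volume {t ∈ cube d T | s < Z t ω}

/-- `∫_0^∞ P( ∫_{[0,T]^d} 𝕀(Z(t) > s) dt > x ) ds`. -/
def bermanOnCube [MeasurableSpace Ω] (P : Measure Ω) (Z : (Fin d → ℝ) → Ω → ℝ) (T x : ℝ) : ℝ≥0∞ :=
  ∫⁻ s in Set.Ioi (0 : ℝ), P {ω | ENNReal.ofReal x < sojourn Z T s ω}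

/-- The Berman function: the limit as `T → ∞` of `T^{-d}` times `bermanOnCube P Z T x`. -/
def bermanFunction [MeasurableSpace Ω] (P : Measure Ω) (Z : (Fin d → ℝ) → Ω → ℝ) (x : ℝ) : ℝ≥0∞ :=
  limUnder atTop (fun T : ℝ => bermanOnCube P Z T x / ENNReal.ofReal (T ^ d))

end Berman

end

/-! Pushing `P ⊗ ds` forward under `(ω, s) ↦ Z(ω)/s` gives the exponent measure `ν` on path space.
With `V_Q` the volume of the part of `Q` where a path exceeds 1, `bermanOnCube` is `ν(V_{[0,T]^d} >
x)`.

Stationarity of the max-stable field makes the finite-dimensional tails of `ν` shift-invariant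
(`lintegral_exceedProb_shift`). Spreading the mass of each path uniformly over its exceedance set
and recentring there (`lintegral_exceedVolume`) turns `T^{-d} ν(V_{[0,T]^d} > y)` into an average
over `u ∈ [0,1]^d` of the integral of `1(V > y)/V` against `ν` restricted to `f(0) > 1`, a finite
measure; here `V` is taken over the cube seen from `T u`. These windows increase to the whole space,
so the candidate limit is `recipMass ν y`, where `V` is the total exceedance volume.

For `y > 0` the integrand is at most `1/y` and dominated convergence applies. For `y = 0` Fatou
gives the lower bound. The upper bound compares with small `y > 0`: the error comes from paths whose
exceedance volume in one of `O(T^d)` unit cubes lies in `(0, y]` (`exceedMass_zero_le`), and it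
vanishes as `y → 0` because the supremum over a unit cube is integrable.

`recipMass ν` is continuous at `y` once `V = y` has no mass. A continuous path has at most one level
below its value at 0 whose superlevel set has volume `y` (`subsingleton_levels`), so Fubini in `s`
excludes such mass (`ae_exceedVolume_ne`). -/

namespace Berman

/-! ### Renewal measure of the arrival times. -/

section Renewal

instance isProbabilityMeasure_expMeasure_one : IsProbabilityMeasure (expMeasure 1) :=
  isProbabilityMeasure_expMeasure one_pos

lemma lintegral_expMeasure_one {f : ℝ → ℝ≥0∞} (hf : Measurable f) :
    ∫⁻ v, f v ∂(expMeasure 1) = ∫⁻ v in Set.Ioi 0, ENNReal.ofReal (Real.exp (-v)) * f v := by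
  have h : expMeasure 1 = volume.withDensity (exponentialPDF 1) := rfl
  have hm : Measurable (exponentialPDF 1) := (measurable_exponentialPDFReal 1).ennreal_ofReal
  rw [h, lintegral_withDensity_eq_lintegral_mul _ hm hf, ← lintegral_indicator measurableSet_Ioi]
  refine lintegral_congr_ae ?_
  filter_upwards [Measure.ae_ne volume (0 : ℝ)] with v hv
  rcases lt_or_gt_of_ne hv with h0 | h0
  · simp [exponentialPDF_of_neg h0, not_lt.2 h0.le]
  · simp [exponentialPDF_of_nonneg h0.le, h0]

lemma expMeasure_one_Iio_le (w : ℝ) :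
    expMeasure 1 (Set.Iio w) ≤
      (Set.Ioi (0 : ℝ)).indicator (fun w => ENNReal.ofReal (1 - Real.exp (-w))) w := by
  have h : expMeasure 1 (Set.Iic w) = ∫⁻ y in Set.Iic w, exponentialPDF 1 y :=
    withDensity_apply _ measurableSet_Iic
  rw [lintegral_exponentialPDF_eq_antiDeriv one_pos] at h
  refine (measure_mono Set.Iio_subset_Iic_self).trans (h.le.trans ?_)
  by_cases hw : 0 < w
  · simp [hw, hw.le]
  · rw [Set.indicator_of_notMem (by simpa using hw)]
    split_ifs with h0
    · obtain rfl : w = 0 := le_antisymm (not_lt.1 hw) h0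
      simp
    · simp

/-- Lebesgue measure on the half-line convolved with Exp(1) has density `1 - e^{-w}`, which is
complementary to the density `e^{-w}` of the first arrival; this closes the induction in
`sum_lintegral_arrival_le`. -/
lemma lintegral_lintegral_add_expMeasure_le {f : ℝ → ℝ≥0∞} (hf : Measurable f) :
    ∫⁻ u in Set.Ioi (0 : ℝ), ∫⁻ v, f (u + v) ∂(expMeasure 1) ≤
      ∫⁻ w in Set.Ioi (0 : ℝ), ENNReal.ofReal (1 - Real.exp (-w)) * f w := by
  have hshift : ∀ v : ℝ, ∫⁻ u in Set.Ioi (0 : ℝ), f (u + v) =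
      ∫⁻ w, (Set.Iio w).indicator 1 v * f w := by
    intro v
    rw [← lintegral_indicator measurableSet_Ioi,
      ← lintegral_add_right_eq_self (fun w => (Set.Iio w).indicator (1 : ℝ → ℝ≥0∞) v * f w) v]
    refine lintegral_congr fun u => ?_
    by_cases hu : 0 < u <;> simp [hu]
  have hmeas : Measurable (Function.uncurry fun v w : ℝ =>
      (Set.Iio w).indicator (1 : ℝ → ℝ≥0∞) v * f w) := by
    refine Measurable.mul ?_ (hf.comp measurable_snd)
    exact (measurable_const (a := (1 : ℝ≥0∞))).indicator
      (measurableSet_lt measurable_fst measurable_snd)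
  calc ∫⁻ u in Set.Ioi (0 : ℝ), ∫⁻ v, f (u + v) ∂(expMeasure 1)
      = ∫⁻ v, (∫⁻ u in Set.Ioi (0 : ℝ), f (u + v)) ∂(expMeasure 1) :=
        lintegral_lintegral_swap (Measurable.aemeasurable (by fun_prop))
    _ = ∫⁻ v, (∫⁻ w, (Set.Iio w).indicator 1 v * f w) ∂(expMeasure 1) := by simp_rw [hshift]
    _ = ∫⁻ w, ∫⁻ v, (Set.Iio w).indicator 1 v * f w ∂(expMeasure 1) :=
        lintegral_lintegral_swap hmeas.aemeasurable
    _ = ∫⁻ w, expMeasure 1 (Set.Iio w) * f w := by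
        refine lintegral_congr fun w => ?_
        rw [lintegral_mul_const _ (measurable_one.indicator measurableSet_Iio),
          lintegral_indicator_one measurableSet_Iio]
    _ ≤ ∫⁻ w, (Set.Ioi (0 : ℝ)).indicator
          (fun w => ENNReal.ofReal (1 - Real.exp (-w)) * f w) w := by
        refine lintegral_mono fun w => ?_
        rw [Set.indicator_mul_left]
        gcongr
        exact expMeasure_one_Iio_le w
    _ = _ := lintegral_indicator measurableSet_Ioi _

/-- The law of the sequence of independent unit exponential variables. -/
noncomputable abbrev expSequence : Measure (ℕ → ℝ) := Measure.infinitePi (fun _ : ℕ => expMeasure 1)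

@[fun_prop]
lemma measurable_arrival (i : ℕ) : Measurable (arrival i) := by
  unfold arrival
  fun_prop

lemma arrival_zero (v : ℕ → ℝ) : arrival 0 v = v 0 := by simp [arrival]

lemma arrival_succ (i : ℕ) (v : ℕ → ℝ) : arrival (i + 1) v = arrival i v + v (i + 1) :=
  Finset.sum_range_succ _ _

lemma lintegral_eval_expSequence (i : ℕ) {f : ℝ → ℝ≥0∞} (hf : Measurable f) :
    ∫⁻ v, f (v i) ∂expSequence = ∫⁻ u, f u ∂(expMeasure 1) :=
  (measurePreserving_eval_infinitePi (fun _ : ℕ => expMeasure 1) i).lintegral_comp hf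

lemma lintegral_arrival_succ (i : ℕ) {f : ℝ → ℝ≥0∞} (hf : Measurable f) :
    ∫⁻ v, f (arrival (i + 1) v) ∂expSequence =
      ∫⁻ v, ∫⁻ u, f (arrival i v + u) ∂(expMeasure 1) ∂expSequence := by
  have hind : IndepFun (arrival i) (fun v : ℕ → ℝ => v (i + 1)) expSequence := by
    have h := (iIndepFun_infinitePi (P := fun _ : ℕ => expMeasure 1) (X := fun _ x => x)
      (fun _ => measurable_id)).indepFun_finsetSum_of_notMem (fun i => measurable_pi_apply i)
      (s := Finset.range (i + 1)) (i := i + 1) (by simp)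
    convert h using 1
    ext v
    simp [arrival]
  have hmap := (indepFun_iff_map_prod_eq_prod_map_map (measurable_arrival i).aemeasurable
    (measurable_pi_apply (i + 1)).aemeasurable).1 hind
  have heval : expSequence.map (fun v : ℕ → ℝ => v (i + 1)) = expMeasure 1 :=
    (measurePreserving_eval_infinitePi (fun _ : ℕ => expMeasure 1) (i + 1)).map_eq
  have hfa : Measurable fun p : ℝ × ℝ => f (p.1 + p.2) := by fun_prop
  calc ∫⁻ v, f (arrival (i + 1) v) ∂expSequence
      = ∫⁻ p, f (p.1 + p.2) ∂(expSequence.map fun v => (arrival i v, v (i + 1))) := by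
        rw [lintegral_map hfa (by fun_prop)]
        simp_rw [arrival_succ]
    _ = ∫⁻ a, ∫⁻ u, f (a + u) ∂(expMeasure 1) ∂(expSequence.map (arrival i)) := by
        rw [hmap, heval, lintegral_prod _ hfa.aemeasurable]
    _ = _ := lintegral_map hfa.lintegral_prod_right' (measurable_arrival i)

/-- The renewal measure of the unit rate Poisson process is dominated by Lebesgue measure. -/
lemma sum_lintegral_arrival_le (n : ℕ) : ∀ {f : ℝ → ℝ≥0∞}, Measurable f →
    ∑ i ∈ Finset.range n, ∫⁻ v, f (arrival i v) ∂expSequence ≤ ∫⁻ u in Set.Ioi (0 : ℝ), f u := by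
  induction n with
  | zero => simp
  | succ n ih =>
    intro f hf
    have hg : Measurable fun a : ℝ => ∫⁻ u, f (a + u) ∂(expMeasure 1) :=
      Measurable.lintegral_prod_right' (f := fun p : ℝ × ℝ => f (p.1 + p.2)) (by fun_prop)
    -- The first arrival is split off: the later ones are earlier arrivals tested against the
    -- averaged function `g`, to which the induction hypothesis applies.
    rw [Finset.sum_range_succ']
    simp_rw [lintegral_arrival_succ _ hf, arrival_zero]
    rw [lintegral_eval_expSequence 0 hf, lintegral_expMeasure_one hf]
    refine (add_le_add_left ((ih hg).trans (lintegral_lintegral_add_expMeasure_le hf)) _).trans ?_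
    rw [← lintegral_add_left (by fun_prop)]
    refine (setLIntegral_congr_fun measurableSet_Ioi fun w hw => ?_).le
    have h1 : Real.exp (-w) ≤ 1 := Real.exp_le_one_iff.2 (by simpa using (Set.mem_Ioi.1 hw).le)
    simp only [← add_mul]
    rw [← ENNReal.ofReal_add (by linarith) (Real.exp_pos _).le]
    simp

lemma tsum_lintegral_arrival_le {f : ℝ → ℝ≥0∞} (hf : Measurable f) :
    ∑' i, ∫⁻ v, f (arrival i v) ∂expSequence ≤ ∫⁻ u in Set.Ioi (0 : ℝ), f u := by
  rw [ENNReal.tsum_eq_iSup_nat]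
  exact iSup_le fun n => sum_lintegral_arrival_le n hf

lemma ae_arrival_nonneg : ∀ᵐ v ∂expSequence, ∀ i, 0 ≤ arrival i v := by
  have h1 : ∀ᵐ u ∂(expMeasure 1), 0 ≤ u := by
    have : expMeasure 1 (Set.Iio 0) = 0 := by simpa using expMeasure_one_Iio_le 0
    rw [ae_iff]
    simpa [Set.Iio] using this
  have h2 : ∀ᵐ v ∂expSequence, ∀ i, 0 ≤ v i := ae_all_iff.2 fun i =>
    (measurePreserving_eval_infinitePi (fun _ : ℕ => expMeasure 1) i).quasiMeasurePreserving.ae h1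
  filter_upwards [h2] with v hv i
  exact Finset.sum_nonneg fun k _ => hv k

end Renewal

/-! ### From stationarity to shift-invariant exponents. -/

section Exponent

variable {Ω : Type*} [MeasurableSpace Ω] (P : Measure Ω) [IsProbabilityMeasure P] {d : ℕ}
  {Z : (Fin d → ℝ) → Ω → ℝ}

/-- The probability that the field, at finitely many sites, exceeds `r` times given levels. -/
noncomputable def exceedProb (Z : (Fin d → ℝ) → Ω → ℝ) {ι : Type*} (t : ι → Fin d → ℝ) (x : ι → ℝ)
    (r : ℝ) : ℝ≥0∞ :=
  P {ω | ∃ j, r * x j < Z (t j) ω}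

lemma measurableSet_exists_lt (hmeas : ∀ t, Measurable (Z t)) {ι : Type*} [Finite ι]
    (t : ι → Fin d → ℝ) (x : ι → ℝ) :
    MeasurableSet {p : ℝ × Ω | ∃ j, p.1 * x j < Z (t j) p.2} := by
  simp_rw [Set.ofPred_exists]
  exact MeasurableSet.iUnion fun j => measurableSet_lt (by fun_prop)
    ((hmeas (t j)).comp measurable_snd)

lemma measurable_exceedProb (hmeas : ∀ t, Measurable (Z t)) {ι : Type*} [Finite ι]
    (t : ι → Fin d → ℝ) (x : ι → ℝ) : Measurable (exceedProb P Z t x) :=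
  measurable_measure_prodMk_left (measurableSet_exists_lt hmeas t x)

/-- The event that the max-stable field exceeds one of the levels `u * x j`. -/
def maxExceed (Z : (Fin d → ℝ) → Ω → ℝ) {ι : Type*} (t : ι → Fin d → ℝ) (x : ι → ℝ) (u : ℝ) :
    Set ((ℕ → ℝ) × (ℕ → Ω)) :=
  {w | ∃ j, ENNReal.ofReal (u * x j) < maxStableField Z (t j) w}

lemma mem_maxExceed_iff {Ω : Type*} {Z : (Fin d → ℝ) → Ω → ℝ} {ι : Type*}
    {t : ι → Fin d → ℝ} {x : ι → ℝ} (hx : ∀ j, 0 < x j) {u : ℝ} (hu : 0 < u) {w : (ℕ → ℝ) × (ℕ → Ω)} (hw : ∀ i, 0 ≤ arrival i w.1) :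
    w ∈ maxExceed Z t x u ↔
      ∃ i, 0 < arrival i w.1 ∧ ∃ j, (u * arrival i w.1) * x j < Z (t j) (w.2 i) := by
  have key : ∀ i j, ENNReal.ofReal (u * x j) <
      ENNReal.ofReal ((arrival i w.1)⁻¹ * Z (t j) (w.2 i)) ↔
      0 < arrival i w.1 ∧ (u * arrival i w.1) * x j < Z (t j) (w.2 i) := by
    intro i j
    have hux : 0 < u * x j := mul_pos hu (hx j)
    rw [ENNReal.ofReal_lt_ofReal_iff_of_nonneg hux.le]
    rcases (hw i).eq_or_lt with h0 | h0
    -- Since `0⁻¹ = 0`, a vanishing arrival contributes 0 and exceeds no positive level.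
    · simp [← h0, hux.le]
    · rw [inv_mul_eq_div, lt_div_iff₀ h0]
      simp only [h0, true_and]
      rw [mul_right_comm]
  simp only [maxExceed, Set.mem_ofPred_eq, maxStableField, lt_iSup_iff, key]
  constructor
  · rintro ⟨j, i, h0, h⟩
    exact ⟨i, h0, j, h⟩
  · rintro ⟨i, h0, j, h⟩
    exact ⟨j, i, h0, h⟩

lemma ae_deHaanMeasure_arrival_nonneg :
    ∀ᵐ w ∂(deHaanMeasure P), ∀ i, 0 ≤ arrival i w.1 :=
  Measure.quasiMeasurePreserving_fst.ae ae_arrival_nonneg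

lemma deHaanMeasure_exceed_eq (hmeas : ∀ t, Measurable (Z t)) {ι : Type*} [Finite ι]
    (t : ι → Fin d → ℝ) (x : ι → ℝ) (u : ℝ) (i : ℕ) :
    deHaanMeasure P {w | 0 < arrival i w.1 ∧ ∃ j, (u * arrival i w.1) * x j < Z (t j) (w.2 i)} =
      ∫⁻ v, (Set.Ioi (0 : ℝ)).indicator (fun r => exceedProb P Z t x (u * r)) (arrival i v)
        ∂expSequence := by
  have hS := measurableSet_exists_lt hmeas t x
  have hset : MeasurableSet {w : (ℕ → ℝ) × (ℕ → Ω) |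
      0 < arrival i w.1 ∧ ∃ j, (u * arrival i w.1) * x j < Z (t j) (w.2 i)} := by
    refine MeasurableSet.inter (measurableSet_lt measurable_const
      ((measurable_arrival i).comp measurable_fst)) ?_
    have : Measurable fun w : (ℕ → ℝ) × (ℕ → Ω) => (u * arrival i w.1, w.2 i) := by fun_prop
    exact this hS
  rw [deHaanMeasure, Measure.prod_apply hset]
  refine lintegral_congr fun v => ?_
  by_cases hv : 0 < arrival i v
  · have hE : MeasurableSet {ω | ∃ j, (u * arrival i v) * x j < Z (t j) ω} :=
      (measurable_prodMk_left (x := u * arrival i v)) hS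
    have := (measurePreserving_eval_infinitePi (fun _ : ℕ => P) i).measure_preimage
      hE.nullMeasurableSet
    simpa [hv, exceedProb] using this
  · simp [hv]

/-- Union bound over all points, with the renewal estimate. -/
lemma deHaanMeasure_maxExceed_le (hmeas : ∀ t, Measurable (Z t)) {ι : Type*} [Finite ι]
    (t : ι → Fin d → ℝ) {x : ι → ℝ} (hx : ∀ j, 0 < x j) {u : ℝ} (hu : 0 < u) :
    deHaanMeasure P (maxExceed Z t x u) ≤
      ∫⁻ r in Set.Ioi (0 : ℝ), exceedProb P Z t x (u * r) := by
  have hm : Measurable fun r => exceedProb P Z t x (u * r) :=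
    (measurable_exceedProb P hmeas t x).comp (by fun_prop)
  calc deHaanMeasure P (maxExceed Z t x u)
      ≤ deHaanMeasure P (⋃ i, {w | 0 < arrival i w.1 ∧
          ∃ j, (u * arrival i w.1) * x j < Z (t j) (w.2 i)}) := by
        refine measure_mono_ae ?_
        filter_upwards [ae_deHaanMeasure_arrival_nonneg P] with w hw h
        exact Set.mem_iUnion.2 ((mem_maxExceed_iff hx hu hw).1 h)
    _ ≤ ∑' i, deHaanMeasure P {w | 0 < arrival i w.1 ∧
          ∃ j, (u * arrival i w.1) * x j < Z (t j) (w.2 i)} := measure_iUnion_le _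
    _ ≤ ∫⁻ r in Set.Ioi (0 : ℝ), (Set.Ioi (0 : ℝ)).indicator
          (fun r => exceedProb P Z t x (u * r)) r := by
        simp_rw [deHaanMeasure_exceed_eq P hmeas]
        exact tsum_lintegral_arrival_le (hm.indicator measurableSet_Ioi)
    _ = _ := by
        rw [setLIntegral_indicator measurableSet_Ioi, Set.inter_self]

/-- Only the first point is kept. The factor `e^{-r}` lost against the upper bound disappears for
high levels `u`. -/
lemma le_deHaanMeasure_maxExceed (hmeas : ∀ t, Measurable (Z t)) {ι : Type*} [Finite ι]
    (t : ι → Fin d → ℝ) {x : ι → ℝ} (hx : ∀ j, 0 < x j) {u : ℝ} (hu : 0 < u) :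
    ∫⁻ r in Set.Ioi (0 : ℝ), ENNReal.ofReal (Real.exp (-r)) * exceedProb P Z t x (u * r) ≤
      deHaanMeasure P (maxExceed Z t x u) := by
  have hm : Measurable fun r => exceedProb P Z t x (u * r) :=
    (measurable_exceedProb P hmeas t x).comp (by fun_prop)
  calc ∫⁻ r in Set.Ioi (0 : ℝ), ENNReal.ofReal (Real.exp (-r)) * exceedProb P Z t x (u * r)
      = ∫⁻ r, (Set.Ioi (0 : ℝ)).indicator (fun r => exceedProb P Z t x (u * r)) r
          ∂(expMeasure 1) := by
        rw [lintegral_expMeasure_one (hm.indicator measurableSet_Ioi)]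
        exact setLIntegral_congr_fun measurableSet_Ioi fun r hr => by
          simp only [Set.indicator_of_mem hr]
    _ = deHaanMeasure P {w | 0 < arrival 0 w.1 ∧
          ∃ j, (u * arrival 0 w.1) * x j < Z (t j) (w.2 0)} := by
        rw [deHaanMeasure_exceed_eq P hmeas]
        simp_rw [arrival_zero]
        rw [lintegral_eval_expSequence 0 (hm.indicator measurableSet_Ioi)]
    _ ≤ deHaanMeasure P (maxExceed Z t x u) := by
        refine measure_mono_ae ?_
        filter_upwards [ae_deHaanMeasure_arrival_nonneg P] with w hw h
        exact (mem_maxExceed_iff hx hu hw).2 ⟨0, h⟩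

lemma deHaanMeasure_maxExceed_shift
    (hstat : IsStationaryField (deHaanMeasure P) (maxStableField Z)) {ι : Type*} [Finite ι]
    (t : ι → Fin d → ℝ) (x : ι → ℝ) (u : ℝ) (h : Fin d → ℝ) :
    deHaanMeasure P (maxExceed Z (fun j => t j + h) x u) =
      deHaanMeasure P (maxExceed Z t x u) := by
  obtain ⟨n, ⟨e⟩⟩ := Finite.exists_equiv_fin ι
  have hS : MeasurableSet {y : Fin n → ℝ≥0∞ | ∃ j, ENNReal.ofReal (u * x (e.symm j)) < y j} := by
    simp_rw [Set.ofPred_exists]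
    exact MeasurableSet.iUnion fun j => measurableSet_lt measurable_const (by fun_prop)
  have := (hstat h n (fun j => t (e.symm j))).measure_mem_eq hS
  have hE : ∀ s : ι → Fin d → ℝ, maxExceed Z s x u = (fun w j => maxStableField Z (s (e.symm j)) w)
      ⁻¹' {y : Fin n → ℝ≥0∞ | ∃ j, ENNReal.ofReal (u * x (e.symm j)) < y j} := by
    intro s
    ext w
    simp only [maxExceed, Set.mem_ofPred_eq, Set.mem_preimage]
    exact e.exists_congr_left
  rw [hE, hE]
  exact this

lemma lintegral_Ioi_comp_mul {f : ℝ → ℝ≥0∞} (hf : Measurable f) {u : ℝ} (hu : 0 < u) :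
    ENNReal.ofReal u * ∫⁻ r in Set.Ioi (0 : ℝ), f (u * r) = ∫⁻ r in Set.Ioi (0 : ℝ), f r := by
  have h := Real.map_volume_mul_left hu.ne'
  have hg : Measurable ((Set.Ioi (0 : ℝ)).indicator f) := hf.indicator measurableSet_Ioi
  have h2 : ∫⁻ r, (Set.Ioi (0 : ℝ)).indicator f (u * r) =
      ENNReal.ofReal u⁻¹ * ∫⁻ r, (Set.Ioi (0 : ℝ)).indicator f r := by
    rw [← lintegral_map hg (measurable_const_mul u), h, lintegral_smul_measure,
      abs_of_pos (inv_pos.2 hu), smul_eq_mul]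
  have h3 : ∫⁻ r in Set.Ioi (0 : ℝ), f (u * r) = ∫⁻ r, (Set.Ioi (0 : ℝ)).indicator f (u * r) := by
    rw [← lintegral_indicator measurableSet_Ioi]
    refine lintegral_congr fun r => ?_
    by_cases hr : 0 < r
    · simp [hr, hu]
    · simp [hr, hu]
  rw [h3, h2, lintegral_indicator measurableSet_Ioi, ← mul_assoc, ← ENNReal.ofReal_mul hu.le,
    mul_inv_cancel₀ hu.ne', ENNReal.ofReal_one, one_mul]

/-- After rescaling by `u`, the two bounds read `∫ e^{-r/u} p_s(r) dr ≤ u · Pr(maxExceed) ≤ ∫ p_t(r)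
dr`. Letting `u = n + 1 → ∞` removes the exponential, so the exact Poisson formula is not needed. -/
lemma lintegral_exceedProb_le_shift (hmeas : ∀ t, Measurable (Z t)) {ι : Type*} [Finite ι]
    {s t : ι → Fin d → ℝ} {x : ι → ℝ} (hx : ∀ j, 0 < x j)
    (hst : ∀ u, deHaanMeasure P (maxExceed Z s x u) = deHaanMeasure P (maxExceed Z t x u)) :
    ∫⁻ r in Set.Ioi (0 : ℝ), exceedProb P Z s x r ≤
      ∫⁻ r in Set.Ioi (0 : ℝ), exceedProb P Z t x r := by
  have hs := measurable_exceedProb P hmeas s x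
  have ht := measurable_exceedProb P hmeas t x
  have hlim : Tendsto (fun n : ℕ => ∫⁻ r in Set.Ioi (0 : ℝ),
      ENNReal.ofReal (Real.exp (-(r / (n + 1)))) * exceedProb P Z s x r) atTop
      (𝓝 (∫⁻ r in Set.Ioi (0 : ℝ), exceedProb P Z s x r)) := by
    refine lintegral_tendsto_of_tendsto_of_monotone (fun n => by fun_prop) ?_ ?_
    · refine (ae_restrict_iff' measurableSet_Ioi).2 (.of_forall fun r hr m n hmn => ?_)
      have hr : (0 : ℝ) < r := hr
      dsimp only
      gcongr
    · refine .of_forall fun r => ?_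
      have h1 : Tendsto (fun n : ℕ => Real.exp (-(r / ((n : ℝ) + 1)))) atTop (𝓝 1) := by
        have h2 : Tendsto (fun n : ℕ => -(r / ((n : ℝ) + 1))) atTop (𝓝 0) := by
          have := (tendsto_one_div_add_atTop_nhds_zero_nat (𝕜 := ℝ)).const_mul (-r)
          simp only [mul_zero] at this
          refine this.congr fun n => by ring
        simpa [Function.comp_def] using (Real.continuous_exp.tendsto 0).comp h2
      have h3 := ENNReal.Tendsto.mul_const (b := exceedProb P Z s x r)
        (ENNReal.tendsto_ofReal h1) (Or.inl (by simp))
      simpa using h3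
  refine le_of_tendsto' hlim fun n => ?_
  have hu : (0 : ℝ) < n + 1 := by positivity
  have e1 := lintegral_Ioi_comp_mul (f := fun r => ENNReal.ofReal (Real.exp (-(r / (n + 1)))) *
    exceedProb P Z s x r) (by fun_prop) hu
  have e2 := lintegral_Ioi_comp_mul ht hu
  rw [← e1, ← e2]
  refine mul_le_mul_right (le_trans (le_of_eq ?_) ((le_deHaanMeasure_maxExceed P hmeas s hx hu).trans
    ((hst _).le.trans (deHaanMeasure_maxExceed_le P hmeas t hx hu)))) _
  refine lintegral_congr fun r => ?_
  rw [mul_div_cancel_left₀ _ hu.ne']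

/-- Stationarity of the max-stable field forces shift-invariance of the exponent measure. -/
theorem lintegral_exceedProb_shift (hmeas : ∀ t, Measurable (Z t))
    (hstat : IsStationaryField (deHaanMeasure P) (maxStableField Z)) {ι : Type*} [Finite ι]
    (t : ι → Fin d → ℝ) {x : ι → ℝ} (hx : ∀ j, 0 < x j) (h : Fin d → ℝ) :
    ∫⁻ r in Set.Ioi (0 : ℝ), exceedProb P Z (fun j => t j + h) x r =
      ∫⁻ r in Set.Ioi (0 : ℝ), exceedProb P Z t x r :=
  le_antisymm
    (lintegral_exceedProb_le_shift P hmeas hx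
      fun u => deHaanMeasure_maxExceed_shift P hstat t x u h)
    (lintegral_exceedProb_le_shift P hmeas hx
      fun u => (deHaanMeasure_maxExceed_shift P hstat t x u h).symm)

end Exponent

/-! ### Path space and exceedance volumes. -/

lemma measurable_of_le_pos {α : Type*} [MeasurableSpace α] {g : α → ℝ} (hg : ∀ a, 0 ≤ g a)
    (h : ∀ x, 0 < x → MeasurableSet {a | g a ≤ x}) : Measurable g := by
  refine measurable_of_Iic fun x => ?_
  rcases lt_trichotomy x 0 with hx | rfl | hx
  · convert MeasurableSet.empty
    ext a
    simpa using hx.trans_le (hg a)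
  · have : g ⁻¹' Set.Iic 0 = ⋂ n : ℕ, {a | g a ≤ 1 / ((n : ℝ) + 1)} := by
      ext a
      simp only [Set.mem_preimage, Set.mem_Iic, Set.mem_iInter, Set.mem_ofPred_eq]
      exact ⟨fun ha n => ha.trans (by positivity),
        fun ha => ge_of_tendsto' tendsto_one_div_add_atTop_nhds_zero_nat ha⟩
    rw [this]
    exact MeasurableSet.iInter fun n => h _ (by positivity)
  · exact h x hx

/-- Non-negative continuous paths on `ℝ^d`, with the σ-algebra generated by the evaluations. -/
abbrev ContPath (d : ℕ) := {f : (Fin d → ℝ) → ℝ // Continuous f ∧ ∀ t, 0 ≤ f t}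

namespace ContPath

variable {d : ℕ}

lemma measurable_eval (t : Fin d → ℝ) : Measurable fun f : ContPath d => f.1 t :=
  (measurable_pi_apply t).comp measurable_subtype_coe

lemma measurable_eval_prod : Measurable fun p : ContPath d × (Fin d → ℝ) => p.1.1 p.2 := by
  have h : Measurable (Function.uncurry fun (t : Fin d → ℝ) (f : ContPath d) => f.1 t) :=
    measurable_uncurry_of_continuous_of_measurable (fun f => f.2.1) measurable_eval
  exact h.comp measurable_swap

/-- The path seen from the point `h`. -/
def shift (h : Fin d → ℝ) (f : ContPath d) : ContPath d :=
  ⟨fun t => f.1 (t + h), f.2.1.comp (by fun_prop), fun t => f.2.2 _⟩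

lemma measurable_shift (h : Fin d → ℝ) : Measurable (shift h : ContPath d → ContPath d) :=
  Measurable.subtype_mk (measurable_pi_lambda _ fun t => measurable_eval (t + h))

/-- The set of paths that stay below finitely many positive levels. -/
def lowerSets (d : ℕ) : Set (Set (ContPath d)) :=
  {A | ∃ (ι : Type) (_ : Finite ι) (t : ι → Fin d → ℝ) (x : ι → ℝ),
    (∀ j, 0 < x j) ∧ A = {f | ∀ j, f.1 (t j) ≤ x j}}

lemma isPiSystem_lowerSets : IsPiSystem (lowerSets d) := by
  rintro _ ⟨ι, _, t, x, hx, rfl⟩ _ ⟨κ, _, s, y, hy, rfl⟩ -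
  refine ⟨ι ⊕ κ, inferInstance, Sum.elim t s, Sum.elim x y, ?_, ?_⟩
  · rintro (j | j)
    exacts [hx j, hy j]
  · ext f
    simp

/-- Positive levels suffice because paths are non-negative. This matters since tails of the exponent
measure are controlled only at positive levels. -/
lemma generateFrom_lowerSets :
    (inferInstance : MeasurableSpace (ContPath d)) =
      MeasurableSpace.generateFrom (lowerSets d) := by
  refine le_antisymm ?_ (MeasurableSpace.generateFrom_le ?_)
  · have hpos : ∀ (t : Fin d → ℝ) (x : ℝ), 0 < x →
        MeasurableSet[MeasurableSpace.generateFrom (lowerSets d)] {f : ContPath d | f.1 t ≤ x} :=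
      fun t x hx => MeasurableSpace.measurableSet_generateFrom
        ⟨Unit, inferInstance, fun _ => t, fun _ => x, fun _ => hx, by simp⟩
    have heval : ∀ t : Fin d → ℝ, Measurable[MeasurableSpace.generateFrom (lowerSets d)]
        fun f : ContPath d => f.1 t :=
      fun t => @measurable_of_le_pos _ (_) _ (fun f => f.2.2 t) (hpos t)
    have hle : Measurable[MeasurableSpace.generateFrom (lowerSets d)]
        (Subtype.val : ContPath d → _) :=
      @measurable_pi_lambda _ _ _ (_) _ _ fun t => heval t
    exact hle.comap_le
  · rintro _ ⟨ι, _, t, x, -, rfl⟩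
    rw [Set.ofPred_forall]
    exact MeasurableSet.iInter fun j => measurableSet_le (measurable_eval _) measurable_const

/-- The Lebesgue measure of the part of `Q` on which the path exceeds `1`. -/
noncomputable def exceedVolume (Q : Set (Fin d → ℝ)) (f : ContPath d) : ℝ≥0∞ :=
  volume {t ∈ Q | 1 < f.1 t}

lemma measurable_exceedVolume_prod {α : Type*} [MeasurableSpace α] {S : Set (α × (Fin d → ℝ))}
    (hS : MeasurableSet S) :
    Measurable fun p : α × ContPath d => exceedVolume {t | (p.1, t) ∈ S} p.2 := by
  have hT : MeasurableSet {q : (α × ContPath d) × (Fin d → ℝ) |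
      (q.1.1, q.2) ∈ S ∧ 1 < q.1.2.1 q.2} := by
    refine MeasurableSet.inter ?_ (measurableSet_lt measurable_const
      (measurable_eval_prod.comp (by fun_prop : Measurable
        fun q : (α × ContPath d) × (Fin d → ℝ) => (q.1.2, q.2))))
    exact (by fun_prop : Measurable
      fun q : (α × ContPath d) × (Fin d → ℝ) => (q.1.1, q.2)) hS
  exact measurable_measure_prodMk_left hT

lemma measurable_exceedVolume {Q : Set (Fin d → ℝ)} (hQ : MeasurableSet Q) :
    Measurable (exceedVolume Q : ContPath d → ℝ≥0∞) :=
  (measurable_exceedVolume_prod (α := Unit) (S := Prod.snd ⁻¹' Q) (measurable_snd hQ)).comp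
    (measurable_const (a := ()) |>.prodMk measurable_id)

lemma exceedVolume_mono {Q R : Set (Fin d → ℝ)} (h : Q ⊆ R) (f : ContPath d) :
    exceedVolume Q f ≤ exceedVolume R f :=
  measure_mono fun _ ht => ⟨h ht.1, ht.2⟩

lemma exceedVolume_le (Q : Set (Fin d → ℝ)) (f : ContPath d) : exceedVolume Q f ≤ volume Q :=
  measure_mono fun _ ht => ht.1

lemma exceedVolume_iUnion_le {κ : Type*} [Fintype κ] (Q : κ → Set (Fin d → ℝ)) (f : ContPath d) :
    exceedVolume (⋃ k, Q k) f ≤ ∑ k, exceedVolume (Q k) f := by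
  refine le_trans (measure_mono ?_) (measure_iUnion_fintype_le volume fun k => {t ∈ Q k | 1 < f.1 t})
  rintro t ⟨ht, h1⟩
  obtain ⟨k, hk⟩ := Set.mem_iUnion.1 ht
  exact Set.mem_iUnion.2 ⟨k, hk, h1⟩

lemma exceedVolume_shift (Q : Set (Fin d → ℝ)) (a : Fin d → ℝ) (f : ContPath d) :
    exceedVolume ((· + a) ⁻¹' Q) (shift a f) = exceedVolume Q f :=
  measure_preimage_add_right volume a {t ∈ Q | 1 < f.1 t}

lemma lintegral_indicator_exceed (Q : Set (Fin d → ℝ)) (f : ContPath d) :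
    ∫⁻ t in Q, {t | 1 < f.1 t}.indicator 1 t = exceedVolume Q f := by
  have hm : MeasurableSet {t | 1 < f.1 t} := measurableSet_lt measurable_const f.2.1.measurable
  rw [lintegral_indicator_one hm, Measure.restrict_apply hm, Set.inter_comm]
  rfl

end ContPath

/-! ### Shift-invariance on path space and mass transport. -/

open ContPath

/-- A measure on paths whose finite-dimensional tails are shift-invariant and finite. -/
structure IsStationaryExponent {d : ℕ} (ν : Measure (ContPath d)) : Prop where
  shift_eq : ∀ {ι : Type} [Finite ι] (t : ι → Fin d → ℝ) (x : ι → ℝ), (∀ j, 0 < x j) →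
    ∀ h : Fin d → ℝ, ν {f | ∃ j, x j < f.1 (t j + h)} = ν {f | ∃ j, x j < f.1 (t j)}
  finite : ∀ (t : Fin d → ℝ) (x : ℝ), 0 < x → ν {f | x < f.1 t} ≠ ∞

/-- The restriction of the exponent measure to paths that exceed `1` at the origin. -/
noncomputable def atOrigin {d : ℕ} (ν : Measure (ContPath d)) : Measure (ContPath d) :=
  ν.restrict {f | 1 < f.1 0}

namespace IsStationaryExponent

variable {d : ℕ} {ν : Measure (ContPath d)}

lemma finite_exists (hν : IsStationaryExponent ν) {ι : Type} [Finite ι] (t : ι → Fin d → ℝ)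
    (x : ι → ℝ) (hx : ∀ j, 0 < x j) : ν {f | ∃ j, x j < f.1 (t j)} ≠ ∞ := by
  have := Fintype.ofFinite ι
  rw [Set.ofPred_exists]
  refine ((measure_iUnion_fintype_le ν _).trans_lt ?_).ne
  exact ENNReal.sum_lt_top.2 fun j _ => (hν.finite _ _ (hx j)).lt_top

lemma isFiniteMeasure_atOrigin (hν : IsStationaryExponent ν) : IsFiniteMeasure (atOrigin ν) :=
  ⟨by simpa [atOrigin] using (hν.finite 0 1 one_pos).lt_top⟩

/-- A lower set may have infinite mass; cut down to `f(s) > 1` it becomes a difference of two finite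
tail masses. `none` stands for the extra site `s` with level 1. -/
lemma measure_lowerSet_inter (hν : IsStationaryExponent ν) {ι : Type} [Finite ι]
    (t : ι → Fin d → ℝ) (x : ι → ℝ) (hx : ∀ j, 0 < x j) (s : Fin d → ℝ) :
    ν ({f | ∀ j, f.1 (t j) ≤ x j} ∩ {f | 1 < f.1 s}) =
      ν {f | ∃ j : Option ι, (j.elim 1 x : ℝ) < f.1 (j.elim s t)} -
        ν {f | ∃ j, x j < f.1 (t j)} := by
  have hm : MeasurableSet {f : ContPath d | ∃ j, x j < f.1 (t j)} := by
    rw [Set.ofPred_exists]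
    exact MeasurableSet.iUnion fun j => measurableSet_lt measurable_const (measurable_eval _)
  rw [← measure_sdiff _ hm.nullMeasurableSet (hν.finite_exists t x hx)]
  · congr 1
    ext f
    simp only [Set.mem_inter_iff, Set.mem_ofPred_eq, Set.mem_sdiff, Option.exists, not_exists,
      not_lt, Option.elim]
    constructor
    · rintro ⟨h1, h2⟩
      exact ⟨Or.inl h2, h1⟩
    · rintro ⟨h1 | ⟨j, hj⟩, h2⟩
      · exact ⟨h2, h1⟩
      · exact absurd hj (not_lt.2 (h2 j))
  · rintro f ⟨j, hj⟩
    exact ⟨some j, hj⟩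

lemma map_shift_restrict (hν : IsStationaryExponent ν) (h : Fin d → ℝ) :
    (ν.restrict {f | 1 < f.1 h}).map (shift h) = atOrigin ν := by
  have hE : ∀ s : Fin d → ℝ, MeasurableSet {f : ContPath d | 1 < f.1 s} := fun s =>
    measurableSet_lt measurable_const (measurable_eval s)
  have hfin : IsFiniteMeasure (ν.restrict {f | 1 < f.1 h}) :=
    ⟨by simpa using (hν.finite h 1 one_pos).lt_top⟩
  have key : ∀ A ∈ lowerSets d,
      (ν.restrict {f | 1 < f.1 h}).map (shift h) A = atOrigin ν A := by
    rintro _ ⟨ι, _, t, x, hx, rfl⟩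
    have hA : MeasurableSet {f : ContPath d | ∀ j, f.1 (t j) ≤ x j} := by
      rw [Set.ofPred_forall]
      exact MeasurableSet.iInter fun j => measurableSet_le (measurable_eval _) measurable_const
    rw [Measure.map_apply (measurable_shift h) hA,
      Measure.restrict_apply (measurable_shift h hA), atOrigin, Measure.restrict_apply hA,
      hν.measure_lowerSet_inter t x hx 0]
    have e1 := hν.measure_lowerSet_inter (fun j => t j + h) x hx h
    have e2 := hν.shift_eq t x hx h
    have e3 := hν.shift_eq (fun j : Option ι => j.elim 0 t) (fun j => (j.elim 1 x : ℝ))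
      (by rintro (_ | j); exacts [one_pos, hx j]) h
    rw [← e2, ← e3]
    refine Eq.trans e1 ?_
    congr 2
    ext f
    simp [Option.exists]
  refine ext_of_generate_finite _ generateFrom_lowerSets isPiSystem_lowerSets key ?_
  -- With no constraints the lower set is the whole space, which compares the total masses.
  exact key _ ⟨Empty, inferInstance, Empty.elim, Empty.elim, by simp, by simp⟩

/-- Mass transport: a functional of the exceedance volume over `Q` is computed by distributing it
uniformly over the exceedance set and recentring. -/
lemma lintegral_exceedVolume [SFinite ν] (hν : IsStationaryExponent ν) {Q : Set (Fin d → ℝ)}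
    (hQ : MeasurableSet Q) (hQfin : volume Q ≠ ∞) {ψ : ℝ≥0∞ → ℝ≥0∞} (hψ : Measurable ψ)
    (hψ0 : ψ 0 = 0) :
    ∫⁻ f, ψ (exceedVolume Q f) ∂ν =
      ∫⁻ t in Q, ∫⁻ f, ψ (exceedVolume ((· + t) ⁻¹' Q) f) / exceedVolume ((· + t) ⁻¹' Q) f
        ∂(atOrigin ν) := by
  have hV := measurable_exceedVolume hQ
  have hF : Measurable fun f : ContPath d => ψ (exceedVolume Q f) / exceedVolume Q f :=
    (hψ.comp hV).div hV
  have hS : MeasurableSet {p : ContPath d × (Fin d → ℝ) | 1 < p.1.1 p.2} :=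
    measurableSet_lt measurable_const measurable_eval_prod
  -- Uniform spreading over the exceedance set; `ψ 0 = 0` covers paths with no exceedance volume,
  -- where the quotient is `0 / 0 = 0`.
  have h1 : ∀ f : ContPath d, ψ (exceedVolume Q f) = ∫⁻ t in Q,
      {t | 1 < f.1 t}.indicator 1 t * (ψ (exceedVolume Q f) / exceedVolume Q f) := by
    intro f
    have hm : MeasurableSet {t | 1 < f.1 t} := measurableSet_lt measurable_const f.2.1.measurable
    rw [lintegral_mul_const _ (measurable_one.indicator hm), lintegral_indicator_exceed]
    by_cases h0 : exceedVolume Q f = 0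
    · simp [h0, hψ0]
    · rw [ENNReal.mul_div_cancel h0 (ne_top_of_le_ne_top hQfin (exceedVolume_le Q f))]
  calc ∫⁻ f, ψ (exceedVolume Q f) ∂ν
      = ∫⁻ f, (∫⁻ t in Q,
          {t | 1 < f.1 t}.indicator 1 t * (ψ (exceedVolume Q f) / exceedVolume Q f)) ∂ν :=
        lintegral_congr h1
    _ = ∫⁻ t in Q, ∫⁻ f,
          {t | 1 < f.1 t}.indicator 1 t * (ψ (exceedVolume Q f) / exceedVolume Q f) ∂ν := by
        refine lintegral_lintegral_swap (Measurable.aemeasurable ?_)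
        exact (measurable_one.indicator hS).mul (hF.comp measurable_fst)
    _ = _ := by
        refine lintegral_congr fun t => ?_
        have hE : MeasurableSet {f : ContPath d | 1 < f.1 t} :=
          measurableSet_lt measurable_const (measurable_eval t)
        have hQt : MeasurableSet ((· + t) ⁻¹' Q) := (measurable_add_const t) hQ
        have hG : Measurable fun f : ContPath d => ψ (exceedVolume ((· + t) ⁻¹' Q) f) /
            exceedVolume ((· + t) ⁻¹' Q) f :=
          ((hψ.comp (measurable_exceedVolume hQt)).div (measurable_exceedVolume hQt))
        -- The indicator restricts `ν` to paths exceeding 1 at `t`; shifting by `t` carries this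
        -- restriction to the origin.
        rw [← hν.map_shift_restrict t, lintegral_map hG (measurable_shift t),
          ← lintegral_indicator hE]
        refine lintegral_congr fun f => ?_
        by_cases hf : 1 < f.1 t <;> simp [hf, exceedVolume_shift]

lemma lintegral_exceedVolume_translate [SFinite ν] (hν : IsStationaryExponent ν)
    {Q : Set (Fin d → ℝ)} (hQ : MeasurableSet Q) (hQfin : volume Q ≠ ∞) {ψ : ℝ≥0∞ → ℝ≥0∞}
    (hψ : Measurable ψ) (hψ0 : ψ 0 = 0) (a : Fin d → ℝ) :
    ∫⁻ f, ψ (exceedVolume ((· + a) ⁻¹' Q) f) ∂ν = ∫⁻ f, ψ (exceedVolume Q f) ∂ν := by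
  have hQa : MeasurableSet ((· + a) ⁻¹' Q) := (measurable_add_const a) hQ
  rw [hν.lintegral_exceedVolume hQ hQfin hψ hψ0, hν.lintegral_exceedVolume hQa
    (by rwa [measure_preimage_add_right]) hψ hψ0, ← lintegral_indicator hQa,
    ← lintegral_indicator hQ]
  refine Eq.trans (lintegral_congr fun t => ?_) (lintegral_add_right_eq_self _ a)
  have : (· + t) ⁻¹' ((· + a) ⁻¹' Q) = (· + (t + a)) ⁻¹' Q := by
    ext s
    simp [add_assoc]
  by_cases ht : t + a ∈ Q
  · rw [Set.indicator_of_mem ht, Set.indicator_of_mem (by exact ht), this]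
  · rw [Set.indicator_of_notMem ht, Set.indicator_of_notMem (by exact ht)]

end IsStationaryExponent

open ContPath

/-! ### Truncated reciprocals. -/

section Weights

/-- The indicator of `y < v`. -/
noncomputable def exceedInd (y v : ℝ≥0∞) : ℝ≥0∞ := if y < v then 1 else 0

@[fun_prop]
lemma measurable_exceedInd (y : ℝ≥0∞) : Measurable (exceedInd y) :=
  Measurable.ite measurableSet_Ioi measurable_const measurable_const

@[simp] lemma exceedInd_zero (y : ℝ≥0∞) : exceedInd y 0 = 0 := by simp [exceedInd]

/-- The reciprocal of `v`, cut off at the level `y`. -/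
noncomputable def invAbove (y v : ℝ≥0∞) : ℝ≥0∞ := exceedInd y v / v

@[fun_prop]
lemma measurable_invAbove (y : ℝ≥0∞) : Measurable (invAbove y) :=
  (measurable_exceedInd y).div measurable_id

lemma invAbove_of_lt {y v : ℝ≥0∞} (h : y < v) : invAbove y v = v⁻¹ := by
  simp [invAbove, exceedInd, h]

lemma invAbove_of_le {y v : ℝ≥0∞} (h : v ≤ y) : invAbove y v = 0 := by
  simp [invAbove, exceedInd, not_lt.2 h]

lemma invAbove_le_inv (y v : ℝ≥0∞) : invAbove y v ≤ y⁻¹ := by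
  rcases lt_or_ge y v with h | h
  · rw [invAbove_of_lt h]
    exact ENNReal.inv_le_inv.2 h.le
  · simp [invAbove_of_le h]

lemma invAbove_le_invAbove_zero (y v : ℝ≥0∞) : invAbove y v ≤ invAbove 0 v := by
  rcases lt_or_ge y v with h | h
  · rw [invAbove_of_lt h, invAbove_of_lt (pos_of_gt h)]
  · simp [invAbove_of_le h]

/-- Approach from below is essential: at `v = y`, values above `y` would give the limit `1/y`
instead of 0. -/
lemma tendsto_invAbove_of_le {α : Type*} {l : Filter α} {V : α → ℝ≥0∞} {v : ℝ≥0∞} (y : ℝ≥0∞)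
    (hV : Tendsto V l (𝓝 v)) (hle : ∀ a, V a ≤ v) :
    Tendsto (fun a => invAbove y (V a)) l (𝓝 (invAbove y v)) := by
  rcases lt_or_ge y v with h | h
  · rw [invAbove_of_lt h]
    refine (hV.inv).congr' ?_
    filter_upwards [hV.eventually_const_lt h] with a ha
    rw [invAbove_of_lt ha]
  · rw [invAbove_of_le h]
    refine tendsto_const_nhds.congr fun a => ?_
    rw [invAbove_of_le ((hle a).trans h)]

lemma tendsto_invAbove_level {y v : ℝ≥0∞} (h : v ≠ y) :
    Tendsto (fun z => invAbove z v) (𝓝 y) (𝓝 (invAbove y v)) := by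
  refine tendsto_const_nhds.congr' ?_
  rcases lt_or_gt_of_ne h with h | h
  · filter_upwards [lt_mem_nhds h] with z hz
    rw [invAbove_of_le h.le, invAbove_of_le hz.le]
  · filter_upwards [gt_mem_nhds h] with z hz
    rw [invAbove_of_lt h, invAbove_of_lt hz]

end Weights

/-! ### Growing windows and unit-cube covers. -/

section Cubes

variable {d : ℕ}

lemma measurableSet_cube (T : ℝ) : MeasurableSet (cube d T) := measurableSet_Icc

lemma volume_cube {T : ℝ} (hT : 0 ≤ T) : volume (cube d T) = ENNReal.ofReal (T ^ d) := by
  simp [cube, Real.volume_Icc_pi, ENNReal.ofReal_pow hT]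

lemma volume_cube_ne_top (T : ℝ) : volume (cube d T) ≠ ∞ :=
  isCompact_Icc.measure_lt_top.ne

lemma volume_cube_one : volume (cube d 1) = 1 := by simp [volume_cube]

/-- The cube `[0,T]^d` recentred at its point `T u`. -/
def window (T : ℝ) (u : Fin d → ℝ) : Set (Fin d → ℝ) := (· + T • u) ⁻¹' cube d T

lemma mem_window {T : ℝ} {u s : Fin d → ℝ} :
    s ∈ window T u ↔ ∀ i, 0 ≤ s i + T * u i ∧ s i + T * u i ≤ T := by
  simp only [window, cube, Set.mem_preimage, Set.mem_Icc, Pi.le_def, Pi.add_apply, Pi.smul_apply,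
    smul_eq_mul, Pi.zero_apply, forall_and]

/-- In each coordinate the window is `[-T u i, T (1 - u i)]`, which grows in both directions for
interior `u`. -/
lemma window_mono {u : Fin d → ℝ} (hu : ∀ i, 0 < u i ∧ u i < 1) :
    Monotone fun T : ℝ => window T u := by
  intro S T hST s hs
  rw [mem_window] at hs ⊢
  intro i
  have h1 := mul_nonneg (sub_nonneg.2 hST) (hu i).1.le
  have h2 := mul_nonneg (sub_nonneg.2 hST) (sub_nonneg.2 (hu i).2.le)
  constructor
  · linarith [(hs i).1]
  · linarith [(hs i).2]

lemma iUnion_window {u : Fin d → ℝ} (hu : ∀ i, 0 < u i ∧ u i < 1) :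
    ⋃ T : ℝ, window T u = Set.univ := by
  refine Set.eq_univ_of_forall fun s => Set.mem_iUnion.2 ?_
  have h : ∀ᶠ T : ℝ in atTop, ∀ i, 0 ≤ s i + T * u i ∧ s i + T * u i ≤ T := by
    refine eventually_all.2 fun i => ?_
    filter_upwards [eventually_ge_atTop (-s i / u i), eventually_ge_atTop (s i / (1 - u i))]
      with T h1 h2
    rw [div_le_iff₀ (hu i).1] at h1
    rw [div_le_iff₀ (sub_pos.2 (hu i).2)] at h2
    constructor <;> linarith
  obtain ⟨T, hT⟩ := h.exists
  exact ⟨T, mem_window.2 hT⟩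

lemma tendsto_exceedVolume_window {u : Fin d → ℝ} (hu : ∀ i, 0 < u i ∧ u i < 1)
    (f : ContPath d) :
    Tendsto (fun T => exceedVolume (window T u) f) atTop (𝓝 (exceedVolume Set.univ f)) := by
  have hmono : Monotone fun T : ℝ => {t ∈ window T u | 1 < f.1 t} :=
    fun S T hST t ht => ⟨window_mono hu hST ht.1, ht.2⟩
  have h := tendsto_measure_iUnion_atTop (μ := volume) hmono
  have e : ⋃ T : ℝ, {t ∈ window T u | 1 < f.1 t} = {t ∈ Set.univ | 1 < f.1 t} := by
    rw [← iUnion_window hu]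
    ext t
    simp
  rw [e] at h
  exact h

lemma measurable_exceedVolume_window (T : ℝ) :
    Measurable fun p : (Fin d → ℝ) × ContPath d => exceedVolume (window T p.1) p.2 :=
  measurable_exceedVolume_prod (S := {q : (Fin d → ℝ) × (Fin d → ℝ) | q.2 + T • q.1 ∈ cube d T})
    ((by fun_prop : Measurable fun q : (Fin d → ℝ) × (Fin d → ℝ) => q.2 + T • q.1)
      (measurableSet_cube T))

lemma ae_cube_interior :
    ∀ᵐ u ∂(volume.restrict (cube d 1)), ∀ i, 0 < u i ∧ u i < 1 := by
  have h : (Set.univ.pi fun i : Fin d => Set.Ioo ((0 : Fin d → ℝ) i) 1) =ᵐ[volume] cube d 1 :=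
    Measure.univ_pi_Ioo_ae_eq_Icc (μ := fun _ : Fin d => (volume : Measure ℝ))
  rw [← Measure.restrict_congr_set h]
  refine (ae_restrict_iff' (MeasurableSet.univ_pi fun i => measurableSet_Ioo)).2 ?_
  exact .of_forall fun u hu i => hu i (Set.mem_univ i)

lemma lintegral_cube_smul {K : (Fin d → ℝ) → ℝ≥0∞} (hK : Measurable K) {T : ℝ} (hT : 0 < T) :
    ∫⁻ t in cube d T, K t = ENNReal.ofReal (T ^ d) * ∫⁻ u in cube d 1, K (T • u) := by
  have h := Measure.map_addHaar_smul (volume : Measure (Fin d → ℝ)) hT.ne'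
  have hg : Measurable ((cube d T).indicator K) := hK.indicator (measurableSet_cube T)
  have h2 : ∫⁻ u, (cube d T).indicator K (T • u) =
      ENNReal.ofReal (T ^ d)⁻¹ * ∫⁻ t, (cube d T).indicator K t := by
    rw [← lintegral_map hg (measurable_const_smul T), h, lintegral_smul_measure, smul_eq_mul,
      abs_of_pos (by positivity)]
    simp
  have h3 : ∫⁻ u in cube d 1, K (T • u) = ∫⁻ u, (cube d T).indicator K (T • u) := by
    rw [← lintegral_indicator (measurableSet_cube 1)]
    refine lintegral_congr fun u => ?_
    have : T • u ∈ cube d T ↔ u ∈ cube d 1 := by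
      simp only [cube, Set.mem_Icc, Pi.le_def, Pi.smul_apply, smul_eq_mul, Pi.zero_apply]
      refine and_congr (forall_congr' fun i => ?_) (forall_congr' fun i => ?_)
      · exact mul_nonneg_iff_of_pos_left hT
      · exact mul_le_iff_le_one_right hT
    by_cases hu : u ∈ cube d 1
    · rw [Set.indicator_of_mem hu, Set.indicator_of_mem (this.2 hu)]
    · rw [Set.indicator_of_notMem hu, Set.indicator_of_notMem (fun h => hu (this.1 h))]
  rw [h3, h2, lintegral_indicator (measurableSet_cube T), ← mul_assoc,
    ← ENNReal.ofReal_mul (by positivity), mul_inv_cancel₀ (by positivity), ENNReal.ofReal_one,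
    one_mul]

/-- The lower corners of unit cubes that cover `[0,T]^d` from inside. -/
noncomputable def corner (T : ℝ) (k : Fin d → Fin ⌈T⌉₊) : Fin d → ℝ :=
  fun i => min (k i : ℝ) (T - 1)

/-- Capping corners at `T - 1` pulls the last cubes back inside. Equality, not mere covering, is
used: each small cube must lie in the big one. -/
lemma cube_eq_iUnion {T : ℝ} (hT : 1 ≤ T) :
    cube d T = ⋃ k : Fin d → Fin ⌈T⌉₊, (· + -corner T k) ⁻¹' cube d 1 := by
  ext t
  simp only [cube, Set.mem_iUnion, Set.mem_preimage, Set.mem_Icc, Pi.le_def, Pi.add_apply,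
    Pi.zero_apply, Pi.neg_apply, corner, ← forall_and]
  constructor
  · intro h
    have hpos : 0 < ⌈T⌉₊ := Nat.ceil_pos.2 (by linarith)
    have hk : ∀ i, ∃ k : Fin ⌈T⌉₊, 0 ≤ t i + -min (k : ℝ) (T - 1) ∧
        t i + -min (k : ℝ) (T - 1) ≤ 1 := by
      intro i
      obtain ⟨h0, h1⟩ := h i
      rcases lt_or_ge (t i) (T - 1) with hlt | hge
      · refine ⟨⟨⌊t i⌋₊, ?_⟩, ?_⟩
        · have h2 := Nat.floor_le h0
          have h3 := Nat.le_ceil T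
          exact_mod_cast (by linarith : (⌊t i⌋₊ : ℝ) < ⌈T⌉₊)
        · have h2 := Nat.floor_le h0
          have h3 := Nat.lt_floor_add_one (t i)
          rw [min_eq_left (by simp only; linarith)]
          constructor <;> simp only <;> linarith
      · refine ⟨⟨⌈T⌉₊ - 1, by omega⟩, ?_⟩
        have h3 := Nat.le_ceil T
        rw [min_eq_right (by rw [Nat.cast_sub hpos]; push_cast; linarith)]
        constructor <;> linarith
    choose k hk using hk
    exact ⟨k, hk⟩
  · rintro ⟨k, hk⟩ i
    obtain ⟨h0, h1⟩ := hk i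
    have h2 : 0 ≤ min ((k i : ℕ) : ℝ) (T - 1) := le_min (by positivity) (by linarith)
    have h3 := min_le_right ((k i : ℕ) : ℝ) (T - 1)
    constructor <;> linarith

lemma card_corner_le {T : ℝ} (hT : 1 ≤ T) :
    (Fintype.card (Fin d → Fin ⌈T⌉₊) : ℝ≥0∞) ≤ 2 ^ d * ENNReal.ofReal (T ^ d) := by
  have h := (Nat.ceil_lt_add_one (by linarith : 0 ≤ T)).le
  rw [Fintype.card_fun, Fintype.card_fin, Fintype.card_fin, ENNReal.ofReal_pow (by linarith),
    ← mul_pow]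
  push_cast
  gcongr
  rw [← ENNReal.ofReal_natCast, ← ENNReal.ofReal_ofNat, ← ENNReal.ofReal_mul (by norm_num)]
  exact ENNReal.ofReal_le_ofReal (by linarith)

end Cubes

/-! ### Existence of the limit and continuity in the level. -/

section Limit

variable {d : ℕ}

/-- The exponent measure of the event that the exceedance volume over `[0,T]^d` is above `y`. -/
noncomputable def exceedMass (ν : Measure (ContPath d)) (y : ℝ≥0∞) (T : ℝ) : ℝ≥0∞ :=
  ∫⁻ f, exceedInd y (exceedVolume (cube d T) f) ∂ν

/-- The expected reciprocal of the total exceedance volume, cut off at `y`, seen from a typical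
exceedance point. -/
noncomputable def recipMass (ν : Measure (ContPath d)) (y : ℝ≥0∞) : ℝ≥0∞ :=
  ∫⁻ f, invAbove y (exceedVolume Set.univ f) ∂(atOrigin ν)

/-- The exponent measure of the event that the exceedance volume over the unit cube is positive
but at most `y`. -/
noncomputable def smallMass (ν : Measure (ContPath d)) (y : ℝ≥0∞) : ℝ≥0∞ :=
  ∫⁻ f, (Set.Ioc 0 y).indicator 1 (exceedVolume (cube d 1) f) ∂ν

variable {ν : Measure (ContPath d)}

lemma smallMass_le (y : ℝ≥0∞) : smallMass ν y ≤ exceedMass ν 0 1 := by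
  refine lintegral_mono fun f => ?_
  simp only [Set.indicator_apply, exceedInd, Set.mem_Ioc]
  split_ifs <;> simp_all

/-- A fixed positive volume leaves `(0, y]` once `y` is small; the mass of positive volumes
dominates. -/
lemma tendsto_smallMass (hfin : exceedMass ν 0 1 ≠ ∞) :
    Tendsto (smallMass ν) (𝓝 0) (𝓝 0) := by
  have h : Tendsto (smallMass ν) (𝓝 0) (𝓝 (∫⁻ _, 0 ∂ν)) := by
    refine tendsto_lintegral_filter_of_dominated_convergence
      (fun f => exceedInd 0 (exceedVolume (cube d 1) f)) (.of_forall fun y => ?_)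
      (.of_forall fun y => .of_forall fun f => ?_) hfin (.of_forall fun f => ?_)
    · exact (measurable_one.indicator measurableSet_Ioc).comp
        (measurable_exceedVolume (measurableSet_cube 1))
    · simp only [Set.indicator_apply, exceedInd, Set.mem_Ioc]
      split_ifs <;> simp_all
    · refine tendsto_const_nhds.congr' ?_
      by_cases h0 : exceedVolume (cube d 1) f = 0
      · exact .of_forall fun y => by simp [h0]
      · filter_upwards [gt_mem_nhds (pos_iff_ne_zero.2 h0)] with y hy
        rw [Set.indicator_of_notMem fun h => absurd h.2 (not_le.2 hy)]
  simpa using h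

namespace IsStationaryExponent

/-- Mass transport followed by `t = T u`: the integrating measure is now finite and independent of
`T`. -/
lemma exceedMass_div [SFinite ν] (hν : IsStationaryExponent ν) (y : ℝ≥0∞) {T : ℝ} (hT : 0 < T) :
    exceedMass ν y T / ENNReal.ofReal (T ^ d) =
      ∫⁻ p, invAbove y (exceedVolume (window T p.1) p.2)
        ∂((volume.restrict (cube d 1)).prod (atOrigin ν)) := by
  have : IsFiniteMeasure (atOrigin ν) := hν.isFiniteMeasure_atOrigin
  have hW : Measurable fun p : (Fin d → ℝ) × ContPath d =>
      invAbove y (exceedVolume (window T p.1) p.2) :=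
    (measurable_invAbove y).comp (measurable_exceedVolume_window T)
  have hK : Measurable fun t : Fin d → ℝ =>
      ∫⁻ f, invAbove y (exceedVolume ((· + t) ⁻¹' cube d T) f) ∂(atOrigin ν) := by
    refine Measurable.lintegral_prod_right' (f := fun p : (Fin d → ℝ) × ContPath d =>
      invAbove y (exceedVolume ((· + p.1) ⁻¹' cube d T) p.2)) ((measurable_invAbove y).comp ?_)
    exact measurable_exceedVolume_prod
      (S := {q : (Fin d → ℝ) × (Fin d → ℝ) | q.2 + q.1 ∈ cube d T})
      ((by fun_prop : Measurable fun q : (Fin d → ℝ) × (Fin d → ℝ) => q.2 + q.1)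
        (measurableSet_cube T))
  rw [lintegral_prod _ hW.aemeasurable, exceedMass, hν.lintegral_exceedVolume
    (measurableSet_cube T) (volume_cube_ne_top T) (measurable_exceedInd y) (exceedInd_zero y)]
  have h := lintegral_cube_smul hK hT
  have hTd : ENNReal.ofReal (T ^ d) ≠ 0 := by simpa using pow_pos hT d
  refine (congrArg (· / _) h).trans ?_
  rw [mul_comm, ENNReal.mul_div_cancel_right hTd ENNReal.ofReal_ne_top]
  rfl

lemma lintegral_recip_prod (hν : IsStationaryExponent ν) (y : ℝ≥0∞) :
    ∫⁻ p, invAbove y (exceedVolume Set.univ p.2)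
      ∂((volume.restrict (cube d 1)).prod (atOrigin ν)) = recipMass ν y := by
  have : IsFiniteMeasure (atOrigin ν) := hν.isFiniteMeasure_atOrigin
  have hm : Measurable fun p : (Fin d → ℝ) × ContPath d =>
      invAbove y (exceedVolume Set.univ p.2) :=
    (measurable_invAbove y).comp ((measurable_exceedVolume MeasurableSet.univ).comp measurable_snd)
  rw [lintegral_prod _ hm.aemeasurable]
  simp [volume_cube_one, recipMass]

lemma ae_tendsto_invAbove_window (hν : IsStationaryExponent ν) (y : ℝ≥0∞) :
    ∀ᵐ p ∂((volume.restrict (cube d 1)).prod (atOrigin ν)),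
      Tendsto (fun T : ℝ => invAbove y (exceedVolume (window T p.1) p.2)) atTop
        (𝓝 (invAbove y (exceedVolume Set.univ p.2))) := by
  have : IsFiniteMeasure (atOrigin ν) := hν.isFiniteMeasure_atOrigin
  have h : ∀ᵐ p ∂((volume.restrict (cube d 1)).prod (atOrigin ν)), ∀ i, 0 < p.1 i ∧ p.1 i < 1 :=
    Measure.quasiMeasurePreserving_fst.ae ae_cube_interior
  filter_upwards [h] with p hp
  exact tendsto_invAbove_of_le y (tendsto_exceedVolume_window hp p.2)
    fun T => exceedVolume_mono (Set.subset_univ _) _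

lemma tendsto_exceedMass_div [SFinite ν] (hν : IsStationaryExponent ν) {y : ℝ≥0∞} (hy : y ≠ 0) :
    Tendsto (fun T : ℝ => exceedMass ν y T / ENNReal.ofReal (T ^ d)) atTop
      (𝓝 (recipMass ν y)) := by
  have : IsFiniteMeasure (atOrigin ν) := hν.isFiniteMeasure_atOrigin
  rw [← hν.lintegral_recip_prod y]
  have h : Tendsto (fun T : ℝ => ∫⁻ p, invAbove y (exceedVolume (window T p.1) p.2)
        ∂((volume.restrict (cube d 1)).prod (atOrigin ν))) atTop
      (𝓝 (∫⁻ p, invAbove y (exceedVolume Set.univ p.2)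
        ∂((volume.restrict (cube d 1)).prod (atOrigin ν)))) := by
    refine tendsto_lintegral_filter_of_dominated_convergence (fun _ => y⁻¹)
      (.of_forall fun T => (measurable_invAbove y).comp (measurable_exceedVolume_window T))
      (.of_forall fun T => .of_forall fun p => invAbove_le_inv _ _) ?_
      (hν.ae_tendsto_invAbove_window y)
    rw [lintegral_const, ← Set.univ_prod_univ, Measure.prod_prod]
    simpa [volume_cube_one] using
      ENNReal.mul_ne_top (ENNReal.inv_ne_top.2 hy) (measure_ne_top (atOrigin ν) Set.univ)
  refine h.congr' ?_
  filter_upwards [eventually_gt_atTop 0] with T hT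
  exact (hν.exceedMass_div y hT).symm

lemma recipMass_zero_le_liminf [SFinite ν] (hν : IsStationaryExponent ν) :
    recipMass ν 0 ≤ liminf (fun T : ℝ => exceedMass ν 0 T / ENNReal.ofReal (T ^ d)) atTop := by
  have : IsFiniteMeasure (atOrigin ν) := hν.isFiniteMeasure_atOrigin
  calc recipMass ν 0 = ∫⁻ p, liminf
        (fun T : ℝ => invAbove 0 (exceedVolume (window T p.1) p.2)) atTop
        ∂((volume.restrict (cube d 1)).prod (atOrigin ν)) := by
        rw [← hν.lintegral_recip_prod 0]
        refine lintegral_congr_ae ?_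
        filter_upwards [hν.ae_tendsto_invAbove_window 0] with p hp
        exact hp.liminf_eq.symm
    _ ≤ liminf (fun T : ℝ => ∫⁻ p, invAbove 0 (exceedVolume (window T p.1) p.2)
        ∂((volume.restrict (cube d 1)).prod (atOrigin ν))) atTop :=
        lintegral_liminf_le fun T =>
          (measurable_invAbove 0).comp (measurable_exceedVolume_window T)
    _ = _ := by
        refine liminf_congr ?_
        filter_upwards [eventually_gt_atTop 0] with T hT
        exact (hν.exceedMass_div 0 hT).symm

/-- If the volume over the big cube is positive but at most `y`, some unit cube of the cover has
volume in `(0, y]`. All these cubes have the same `smallMass` by translation invariance. -/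
lemma exceedMass_zero_le [SFinite ν] (hν : IsStationaryExponent ν) (y : ℝ≥0∞)
    {T : ℝ} (hT : 1 ≤ T) :
    exceedMass ν 0 T ≤ exceedMass ν y T + 2 ^ d * ENNReal.ofReal (T ^ d) * smallMass ν y := by
  have hind : Measurable ((Set.Ioc 0 y).indicator (1 : ℝ≥0∞ → ℝ≥0∞)) :=
    measurable_one.indicator measurableSet_Ioc
  have hQ : ∀ k : Fin d → Fin ⌈T⌉₊, MeasurableSet ((· + -corner T k) ⁻¹' cube d 1) := fun k =>
    (measurable_add_const _) (measurableSet_cube 1)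
  have hpt : ∀ f : ContPath d, exceedInd 0 (exceedVolume (cube d T) f) ≤
      exceedInd y (exceedVolume (cube d T) f) + ∑ k : Fin d → Fin ⌈T⌉₊,
        (Set.Ioc 0 y).indicator 1 (exceedVolume ((· + -corner T k) ⁻¹' cube d 1) f) := by
    intro f
    rcases lt_or_ge y (exceedVolume (cube d T) f) with h | h
    · refine le_trans ?_ le_self_add
      simp only [exceedInd, h, if_true]
      split_ifs <;> simp
    by_cases h0 : exceedVolume (cube d T) f = 0
    · simp [exceedInd, h0]
    have hle := exceedVolume_iUnion_le
      (fun k : Fin d → Fin ⌈T⌉₊ => (· + -corner T k) ⁻¹' cube d 1) f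
    rw [← cube_eq_iUnion hT] at hle
    obtain ⟨k, -, hk⟩ := Finset.exists_ne_zero_of_sum_ne_zero
      (fun hs => h0 (le_antisymm (hle.trans hs.le) bot_le))
    have hky : exceedVolume ((· + -corner T k) ⁻¹' cube d 1) f ≤ y := by
      refine le_trans (exceedVolume_mono ?_ f) h
      rw [cube_eq_iUnion hT]
      exact Set.subset_iUnion (fun k => (· + -corner T k) ⁻¹' cube d 1) k
    refine le_trans ?_ le_add_self
    refine le_trans ?_ (Finset.single_le_sum (fun _ _ => bot_le) (Finset.mem_univ k))
    have hpos : 0 < exceedVolume ((· + -corner T k) ⁻¹' cube d 1) f := pos_iff_ne_zero.2 hk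
    rw [Set.indicator_of_mem (Set.mem_Ioc.2 ⟨hpos, hky⟩)]
    simp only [exceedInd, Pi.one_apply]
    split_ifs <;> simp
  refine (lintegral_mono hpt).trans ?_
  have hI : Measurable fun f : ContPath d => exceedInd y (exceedVolume (cube d T) f) :=
    (measurable_exceedInd y).comp (measurable_exceedVolume (measurableSet_cube T))
  have hS : ∀ k ∈ Finset.univ, Measurable fun f : ContPath d =>
      (Set.Ioc 0 y).indicator (1 : ℝ≥0∞ → ℝ≥0∞)
        (exceedVolume ((· + -corner T k) ⁻¹' cube d 1) f) :=
    fun k _ => hind.comp (measurable_exceedVolume (hQ k))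
  rw [lintegral_add_left hI, lintegral_finsetSum _ hS]
  refine add_le_add_right ?_ _
  simp_rw [hν.lintegral_exceedVolume_translate (measurableSet_cube 1) (volume_cube_ne_top 1) hind
    (by simp)]
  rw [Finset.sum_const, nsmul_eq_mul, Finset.card_univ]
  exact mul_le_mul_left (card_corner_le hT) _

lemma limsup_exceedMass_zero_le [SFinite ν] (hν : IsStationaryExponent ν) {y : ℝ≥0∞} (hy : y ≠ 0) :
    limsup (fun T : ℝ => exceedMass ν 0 T / ENNReal.ofReal (T ^ d)) atTop ≤
      recipMass ν y + 2 ^ d * smallMass ν y := by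
  have h := (hν.tendsto_exceedMass_div hy).add_const (2 ^ d * smallMass ν y)
  rw [← h.limsup_eq]
  refine limsup_le_limsup ?_
  filter_upwards [eventually_ge_atTop 1] with T hT
  have hTd : ENNReal.ofReal (T ^ d) ≠ 0 := by simpa using pow_pos (by linarith : 0 < T) d
  refine (ENNReal.div_le_div_right (hν.exceedMass_zero_le y hT) _).trans_eq ?_
  rw [ENNReal.add_div, mul_right_comm, ENNReal.mul_div_cancel_right hTd ENNReal.ofReal_ne_top]

/-- The Fatou bound and the covering bound at `y = 1` combine; this supplies the integrable majorant
for continuity at every level. -/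
lemma recipMass_zero_ne_top [SFinite ν] (hν : IsStationaryExponent ν)
    (hfin : exceedMass ν 0 1 ≠ ∞) : recipMass ν 0 ≠ ∞ := by
  have : IsFiniteMeasure (atOrigin ν) := hν.isFiniteMeasure_atOrigin
  refine ne_top_of_le_ne_top ?_ (hν.recipMass_zero_le_liminf.trans
    ((liminf_le_limsup).trans (hν.limsup_exceedMass_zero_le one_ne_zero)))
  refine ENNReal.add_ne_top.2 ⟨?_, ENNReal.mul_ne_top (by simp)
    (ne_top_of_le_ne_top hfin (smallMass_le 1))⟩
  refine ne_top_of_le_ne_top (measure_ne_top (atOrigin ν) Set.univ) ?_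
  calc recipMass ν 1 ≤ ∫⁻ _, 1 ∂(atOrigin ν) :=
        lintegral_mono fun f => (invAbove_le_inv _ _).trans (by simp)
    _ = _ := lintegral_one

lemma recipMass_ne_top [SFinite ν] (hν : IsStationaryExponent ν)
    (hfin : exceedMass ν 0 1 ≠ ∞) (y : ℝ≥0∞) : recipMass ν y ≠ ∞ :=
  ne_top_of_le_ne_top (hν.recipMass_zero_ne_top hfin)
    (lintegral_mono fun _ => invAbove_le_invAbove_zero _ _)

lemma continuousAt_recipMass [SFinite ν] (hν : IsStationaryExponent ν)
    (hfin : exceedMass ν 0 1 ≠ ∞) {y : ℝ≥0∞}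
    (hy : ∀ᵐ f ∂(atOrigin ν), exceedVolume Set.univ f ≠ y) : ContinuousAt (recipMass ν) y := by
  refine tendsto_lintegral_filter_of_dominated_convergence
    (fun f => invAbove 0 (exceedVolume Set.univ f)) (.of_forall fun z => ?_)
    (.of_forall fun z => .of_forall fun f => invAbove_le_invAbove_zero _ _)
    (hν.recipMass_zero_ne_top hfin) ?_
  · exact (measurable_invAbove z).comp (measurable_exceedVolume MeasurableSet.univ)
  · filter_upwards [hy] with f hf
    exact tendsto_invAbove_level hf

lemma tendsto_exceedMass_zero_div [SFinite ν] (hν : IsStationaryExponent ν)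
    (hfin : exceedMass ν 0 1 ≠ ∞) (h0 : ∀ᵐ f ∂(atOrigin ν), exceedVolume Set.univ f ≠ 0) :
    Tendsto (fun T : ℝ => exceedMass ν 0 T / ENNReal.ofReal (T ^ d)) atTop
      (𝓝 (recipMass ν 0)) := by
  refine tendsto_of_le_liminf_of_limsup_le hν.recipMass_zero_le_liminf ?_
  have h1 : Tendsto (fun y => recipMass ν y + 2 ^ d * smallMass ν y) (𝓝[≠] 0)
      (𝓝 (recipMass ν 0 + 2 ^ d * 0)) :=
    (Tendsto.add (hν.continuousAt_recipMass hfin h0) (ENNReal.Tendsto.const_mul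
      (tendsto_smallMass hfin) (Or.inr (ENNReal.pow_ne_top ENNReal.ofNat_ne_top)))).mono_left
      nhdsWithin_le_nhds
  rw [mul_zero, add_zero] at h1
  refine ge_of_tendsto h1 ?_
  filter_upwards [self_mem_nhdsWithin] with y hy
  exact hν.limsup_exceedMass_zero_le hy

end IsStationaryExponent

end Limit

/-! ### Levels with a prescribed superlevel volume. -/

open ContPath

/-- For a continuous function on `ℝ^d`, `d ≥ 1`, at most one level below its value at the origin
has a superlevel set of a prescribed finite volume. -/
lemma subsingleton_levels {d : ℕ} (hd : 1 ≤ d) {g : (Fin d → ℝ) → ℝ} (hg : Continuous g)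
    {y : ℝ≥0∞} (hy : y ≠ ∞) :
    {s : ℝ | s < g 0 ∧ volume {t | s < g t} = y}.Subsingleton := by
  have key : ∀ s s' : ℝ, s' < g 0 → volume {t | s < g t} = y → volume {t | s' < g t} = y →
      ¬ s < s' := by
    intro s s' hs0 hs hs' hlt
    have hm : MeasurableSet {t | s' < g t} := measurableSet_lt measurable_const hg.measurable
    have hdiff : volume ({t | s < g t} \ {t | s' < g t}) = 0 := by
      have hsub : {t | s' < g t} ⊆ {t | s < g t} := fun t (ht : s' < g t) => hlt.trans ht
      rw [measure_sdiff hsub hm.nullMeasurableSet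
        (by rwa [hs']), hs, hs', tsub_self]
    have hU : IsOpen {t | s < g t ∧ g t < s'} :=
      (isOpen_lt continuous_const hg).inter (isOpen_lt hg continuous_const)
    -- Equal finite volumes leave a null open band between the two levels, hence an empty one.
    have hU0 : {t | s < g t ∧ g t < s'} = ∅ := by
      rw [← hU.measure_eq_zero_iff volume]
      have hsub : {t | s < g t ∧ g t < s'} ⊆ {t | s < g t} \ {t | s' < g t} :=
        fun t ht => ⟨ht.1, not_lt.2 ht.2.le⟩
      exact measure_mono_null hsub hdiff
    -- Either the superlevel set is everything, of infinite volume since `d ≥ 1`, or the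
    -- intermediate value theorem produces a point in the band.
    by_cases hall : ∀ t, s < g t
    · have : Nonempty (Fin d) := ⟨⟨0, hd⟩⟩
      have : NoncompactSpace (Fin d → ℝ) := NormedSpace.noncompactSpace ℝ _
      have huniv : {t | s < g t} = Set.univ := Set.eq_univ_of_forall hall
      rw [huniv, measure_univ_of_isAddLeftInvariant] at hs
      exact hy hs.symm
    · obtain ⟨t, ht⟩ := not_forall.1 hall
      obtain ⟨r, hr⟩ := mem_range_of_exists_le_of_exists_ge (c := (s + s') / 2) hg
        ⟨t, by linarith [not_lt.1 ht]⟩ ⟨0, by linarith⟩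
      have : r ∈ {t | s < g t ∧ g t < s'} := ⟨by linarith, by linarith⟩
      simp [hU0] at this
  rintro s ⟨hs0, hs⟩ s' ⟨hs0', hs'⟩
  exact le_antisymm (not_lt.1 (key s' s hs0 hs' hs)) (not_lt.1 (key s s' hs0' hs hs'))

/-! ### The exponent measure of the given field. -/

namespace ContPath

variable {d : ℕ}

/-- The path `f / |s|`. -/
noncomputable def scale (s : ℝ) (f : ContPath d) : ContPath d :=
  ⟨fun t => f.1 t / |s|, f.2.1.div_const _, fun t => div_nonneg (f.2.2 t) (abs_nonneg s)⟩

lemma lt_scale_iff {s : ℝ} (hs : 0 < s) (f : ContPath d) (x : ℝ) (t : Fin d → ℝ) :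
    x < (scale s f).1 t ↔ s * x < f.1 t := by
  have h : (scale s f).1 t = f.1 t / s := by simp only [scale, abs_of_pos hs]
  rw [h, lt_div_iff₀ hs, mul_comm]

lemma exceedVolume_scale {s : ℝ} (hs : 0 < s) (f : ContPath d) (Q : Set (Fin d → ℝ)) :
    exceedVolume Q (scale s f) = volume {t ∈ Q | s < f.1 t} := by
  simp only [exceedVolume, lt_scale_iff hs, mul_one]

lemma measurable_scale_prod {Ω : Type*} [MeasurableSpace Ω] {W : Ω → ContPath d}
    (hW : Measurable W) : Measurable fun p : Ω × ℝ => scale p.2 (W p.1) := by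
  refine Measurable.subtype_mk (measurable_pi_lambda _ fun t => Measurable.div ?_ ?_)
  · exact (measurable_eval t).comp (hW.comp measurable_fst)
  · exact measurable_snd.abs

end ContPath

variable {Ω : Type*} [MeasurableSpace Ω] {d : ℕ}

/-- A random field with a.s. continuous and non-negative trajectories has a modification, off a
null set, that is a random element of the path space. -/
lemma exists_measurable_contPath (P : Measure Ω) (Z : (Fin d → ℝ) → Ω → ℝ)
    (hmeas : ∀ t, Measurable (Z t)) (hnonneg : ∀ᵐ ω ∂P, ∀ t, 0 ≤ Z t ω)
    (hcont : ∀ᵐ ω ∂P, Continuous fun t => Z t ω) :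
    ∃ W : Ω → ContPath d, Measurable W ∧ ∀ᵐ ω ∂P, ∀ t, (W ω).1 t = Z t ω := by
  classical
  -- The set of bad paths need not be measurable, so it is enlarged to a measurable null set.
  let N := toMeasurable P {ω | ¬ ((Continuous fun t => Z t ω) ∧ ∀ t, 0 ≤ Z t ω)}
  have hN : P N = 0 := by
    rw [measure_toMeasurable]
    exact ae_iff.1 (hcont.and hnonneg)
  have hNm : MeasurableSet N := measurableSet_toMeasurable _ _
  have hgood : ∀ ω, ω ∉ N → (Continuous fun t => Z t ω) ∧ ∀ t, 0 ≤ Z t ω := fun ω hω =>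
    not_not.1 fun h => hω (subset_toMeasurable P _ h)
  refine ⟨fun ω => ⟨fun t => if ω ∈ N then 0 else Z t ω, ?_, ?_⟩, ?_, ?_⟩
  · by_cases h : ω ∈ N
    · simp [h, continuous_const]
    · simpa [h] using (hgood ω h).1
  · by_cases h : ω ∈ N
    · simp [h]
    · simpa [h] using (hgood ω h).2
  · exact Measurable.subtype_mk (measurable_pi_lambda _ fun t =>
      Measurable.ite hNm measurable_const (hmeas t))
  · filter_upwards [measure_eq_zero_iff_ae_notMem.1 hN] with ω hω t
    simp [hω]

/-- The exponent measure of the max-stable field with spectral field `W`. -/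
noncomputable def exponentMeasure (P : Measure Ω) (W : Ω → ContPath d) : Measure (ContPath d) :=
  (P.prod (volume.restrict (Set.Ioi (0 : ℝ)))).map fun p => scale p.2 (W p.1)

instance (P : Measure Ω) [SFinite P] (W : Ω → ContPath d) : SFinite (exponentMeasure P W) := by
  unfold exponentMeasure
  infer_instance

section

variable (P : Measure Ω) [IsProbabilityMeasure P] {Z : (Fin d → ℝ) → Ω → ℝ}

lemma exponentMeasure_apply {W : Ω → ContPath d} (hW : Measurable W) {A : Set (ContPath d)}
    (hA : MeasurableSet A) :
    exponentMeasure P W A = ∫⁻ s in Set.Ioi (0 : ℝ), P {ω | scale s (W ω) ∈ A} := by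
  rw [exponentMeasure, Measure.map_apply (measurable_scale_prod hW) hA,
    Measure.prod_apply_symm (measurable_scale_prod hW hA)]
  rfl

lemma exponentMeasure_apply' (P : Measure Ω) {W : Ω → ContPath d} (hW : Measurable W)
    {A : Set (ContPath d)}    (hA : MeasurableSet A) :
    exponentMeasure P W A = ∫⁻ ω, volume ({s | scale s (W ω) ∈ A} ∩ Set.Ioi (0 : ℝ)) ∂P := by
  rw [exponentMeasure, Measure.map_apply (measurable_scale_prod hW) hA,
    Measure.prod_apply (measurable_scale_prod hW hA)]
  refine lintegral_congr fun ω => ?_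
  exact Measure.restrict_apply (measurable_prodMk_left (measurable_scale_prod hW hA))

lemma exponentMeasure_exists_lt {W : Ω → ContPath d} (hW : Measurable W)
    (hWZ : ∀ᵐ ω ∂P, ∀ t, (W ω).1 t = Z t ω) {ι : Type*} [Finite ι] (t : ι → Fin d → ℝ)
    (x : ι → ℝ) :
    exponentMeasure P W {f | ∃ j, x j < f.1 (t j)} =
      ∫⁻ r in Set.Ioi (0 : ℝ), exceedProb P Z t x r := by
  have hA : MeasurableSet {f : ContPath d | ∃ j, x j < f.1 (t j)} := by
    rw [Set.ofPred_exists]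
    exact MeasurableSet.iUnion fun j => measurableSet_lt measurable_const (measurable_eval _)
  rw [exponentMeasure_apply P hW hA]
  refine setLIntegral_congr_fun measurableSet_Ioi fun s hs => measure_congr ?_
  filter_upwards [hWZ] with ω hω
  refine propext (exists_congr fun j => ?_)
  rw [lt_scale_iff hs, hω]

lemma isStationaryExponent_exponentMeasure {W : Ω → ContPath d} (hW : Measurable W)
    (hWZ : ∀ᵐ ω ∂P, ∀ t, (W ω).1 t = Z t ω) (hmeas : ∀ t, Measurable (Z t))
    (hint : ∀ t, Integrable (Z t) P)
    (hstat : IsStationaryField (deHaanMeasure P) (maxStableField Z)) :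
    IsStationaryExponent (exponentMeasure P W) where
  shift_eq t x hx h := by
    rw [exponentMeasure_exists_lt P hW hWZ (fun j => t j + h), exponentMeasure_exists_lt P hW hWZ,
      lintegral_exceedProb_shift P hmeas hstat t hx h]
  finite t x hx := by
    rw [exponentMeasure_apply' P hW (measurableSet_lt measurable_const (measurable_eval t))]
    have hle : ∀ᵐ ω ∂P, volume ({s | scale s (W ω) ∈ {f : ContPath d | x < f.1 t}} ∩
        Set.Ioi (0 : ℝ)) ≤ ENNReal.ofReal (Z t ω / x) := by
      filter_upwards [hWZ] with ω hω
      have hsub : {s | scale s (W ω) ∈ {f : ContPath d | x < f.1 t}} ∩ Set.Ioi (0 : ℝ) ⊆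
          Set.Ioo 0 (Z t ω / x) := by
        rintro s ⟨hs, hs0⟩
        refine ⟨hs0, (lt_div_iff₀ hx).2 ?_⟩
        rw [← hω]
        exact (lt_scale_iff hs0 _ _ _).1 hs
      simpa using measure_mono (μ := volume) hsub
    exact ne_top_of_le_ne_top ((hint t).div_const x).lintegral_lt_top.ne (lintegral_mono_ae hle)

lemma bermanOnCube_eq_exceedMass {W : Ω → ContPath d} (hW : Measurable W)
    (hWZ : ∀ᵐ ω ∂P, ∀ t, (W ω).1 t = Z t ω) (T x : ℝ) :
    bermanOnCube P Z T x = exceedMass (exponentMeasure P W) (ENNReal.ofReal x) T := by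
  have hA : MeasurableSet {f : ContPath d | ENNReal.ofReal x < exceedVolume (cube d T) f} :=
    measurableSet_lt measurable_const (measurable_exceedVolume (measurableSet_cube T))
  have h : exceedMass (exponentMeasure P W) (ENNReal.ofReal x) T =
      exponentMeasure P W {f | ENNReal.ofReal x < exceedVolume (cube d T) f} := by
    rw [← lintegral_indicator_one hA]
    refine lintegral_congr fun f => ?_
    simp [exceedInd, Set.indicator_apply]
  rw [h, exponentMeasure_apply P hW hA]
  refine setLIntegral_congr_fun measurableSet_Ioi fun s hs => measure_congr ?_
  filter_upwards [hWZ] with ω hω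
  change (_ < sojourn Z T s ω) = (_ < exceedVolume (cube d T) (scale s (W ω)))
  rw [exceedVolume_scale hs]
  simp_rw [hω]
  rfl

/-- For fixed `ω`, exceedance of level `s` in the unit cube forces `s ≤ sup`, so the mass is at most
the expected supremum. -/
lemma exceedMass_zero_one_ne_top (P : Measure Ω) {W : Ω → ContPath d} (hW : Measurable W)
    (hsup : ∫⁻ ω, ⨆ t ∈ cube d 1, ENNReal.ofReal ((W ω).1 t) ∂P < ∞) :
    exceedMass (exponentMeasure P W) 0 1 ≠ ∞ := by
  have hA : MeasurableSet {f : ContPath d | 0 < exceedVolume (cube d 1) f} :=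
    measurableSet_lt measurable_const (measurable_exceedVolume (measurableSet_cube 1))
  have h : exceedMass (exponentMeasure P W) 0 1 =
      exponentMeasure P W {f | 0 < exceedVolume (cube d 1) f} := by
    rw [← lintegral_indicator_one hA]
    refine lintegral_congr fun f => ?_
    simp [exceedInd, Set.indicator_apply]
  rw [h, exponentMeasure_apply' P hW hA]
  refine ne_top_of_le_ne_top hsup.ne (lintegral_mono fun ω => ?_)
  set S := ⨆ t ∈ cube d 1, ENNReal.ofReal ((W ω).1 t) with hS
  by_cases hSt : S = ∞
  · simp [hSt]
  have hsub : {s | scale s (W ω) ∈ {f : ContPath d | 0 < exceedVolume (cube d 1) f}} ∩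
      Set.Ioi (0 : ℝ) ⊆ Set.Ioc 0 S.toReal := by
    rintro s ⟨hs, hs0⟩
    have hs1 : 0 < volume {t ∈ cube d 1 | s < (W ω).1 t} := by
      rw [← exceedVolume_scale hs0]
      exact hs
    obtain ⟨t, ht, hst⟩ := nonempty_of_measure_ne_zero hs1.ne'
    refine ⟨hs0, (ENNReal.ofReal_le_iff_le_toReal hSt).1 ?_⟩
    exact (ENNReal.ofReal_le_ofReal hst.le).trans
      (le_iSup₂ (f := fun t (_ : t ∈ cube d 1) => ENNReal.ofReal ((W ω).1 t)) t ht)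
  refine (measure_mono (μ := volume) hsub).trans ?_
  simp [ENNReal.ofReal_toReal hSt]

lemma ae_exceedVolume_ne (P : Measure Ω) (hd : 1 ≤ d) {W : Ω → ContPath d} (hW : Measurable W)
    {y : ℝ≥0∞} (hy : y ≠ ∞) :
    ∀ᵐ f ∂(atOrigin (exponentMeasure P W)), exceedVolume Set.univ f ≠ y := by
  have hV : MeasurableSet {f : ContPath d | exceedVolume Set.univ f = y} :=
    measurable_exceedVolume MeasurableSet.univ (measurableSet_singleton y)
  have hE : MeasurableSet {f : ContPath d | 1 < f.1 0} :=
    measurableSet_lt measurable_const (measurable_eval 0)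
  rw [ae_iff]
  simp only [ne_eq, not_not]
  rw [atOrigin, Measure.restrict_apply hV, exponentMeasure_apply' P hW (hV.inter hE),
    lintegral_eq_zero_iff' ?_]
  · refine .of_forall fun ω => Set.Subsingleton.measure_zero ?_ _
    refine (subsingleton_levels hd (W ω).2.1 hy).anti ?_
    rintro s ⟨⟨hs1, hs2⟩, hs0⟩
    refine ⟨by simpa using (lt_scale_iff hs0 _ _ _).1 hs2, ?_⟩
    have := exceedVolume_scale hs0 (W ω) Set.univ
    simp only [Set.mem_univ, true_and] at this
    rw [← this]
    exact hs1
  · have hm := measurable_scale_prod hW (hV.inter hE)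
    refine (measurable_measure_prodMk_left (ν := volume) (hm.inter
      (measurable_snd measurableSet_Ioi))).aemeasurable

end

end Berman

theorem mainTheorem9 {Ω : Type*} [MeasurableSpace Ω] (P : Measure Ω) [IsProbabilityMeasure P]
    {d : ℕ} (hd : 1 ≤ d) (Z : (Fin d → ℝ) → Ω → ℝ)
    (hmeas : ∀ t, Measurable (Z t))
    (hnonneg : ∀ᵐ ω ∂P, ∀ t, 0 ≤ Z t ω)
    (hmean : ∀ t, ∫ ω, Z t ω ∂P = 1)
    (hsup : ∀ T : ℝ, 0 < T → ∫⁻ ω, ⨆ t ∈ Berman.cube d T, ENNReal.ofReal (Z t ω) ∂P < ∞)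
    (hstat : Berman.IsStationaryField (Berman.deHaanMeasure P) (Berman.maxStableField Z))
    (hcont : ∀ᵐ ω ∂P, Continuous (fun t => Z t ω)) :
    (∀ x : ℝ, 0 ≤ x →
      Tendsto (fun T : ℝ => Berman.bermanOnCube P Z T x / ENNReal.ofReal (T ^ d)) atTop
        (𝓝 (Berman.bermanFunction P Z x)) ∧
      Berman.bermanFunction P Z x < ∞) ∧
    ContinuousOn (Berman.bermanFunction P Z) (Set.Ici 0) := by
  obtain ⟨W, hW, hWZ⟩ := Berman.exists_measurable_contPath P Z hmeas hnonneg hcont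
  have hint : ∀ t, Integrable (Z t) P := fun t => by
    by_contra h
    -- A non-integrable function has Bochner integral 0, contradicting mean 1.
    simpa [integral_undef h] using hmean t
  have hν := Berman.isStationaryExponent_exponentMeasure P hW hWZ hmeas hint hstat
  have hne : ∀ {y : ℝ≥0∞}, y ≠ ∞ → _ := fun {y} hy => Berman.ae_exceedVolume_ne P hd hW hy
  have hfin : Berman.exceedMass (Berman.exponentMeasure P W) 0 1 ≠ ∞ := by
    refine Berman.exceedMass_zero_one_ne_top P hW ?_
    refine lt_of_le_of_lt (lintegral_mono_ae ?_) (hsup 1 one_pos)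
    filter_upwards [hWZ] with ω hω
    simp_rw [hω]
    exact le_rfl
  have hlim : ∀ x : ℝ,
      Tendsto (fun T : ℝ => Berman.bermanOnCube P Z T x / ENNReal.ofReal (T ^ d)) atTop
        (𝓝 (Berman.recipMass (Berman.exponentMeasure P W) (ENNReal.ofReal x))) := by
    intro x
    simp_rw [Berman.bermanOnCube_eq_exceedMass P hW hWZ]
    -- Negative `x` fall under level 0, so the limit exists on all of `ℝ` and continuity can be
    -- proved there.
    by_cases hx : ENNReal.ofReal x = 0
    · rw [hx]
      exact hν.tendsto_exceedMass_zero_div hfin (hne ENNReal.zero_ne_top)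
    · exact hν.tendsto_exceedMass_div hx
  have heq : Berman.bermanFunction P Z =
      fun x => Berman.recipMass (Berman.exponentMeasure P W) (ENNReal.ofReal x) :=
    funext fun x => (hlim x).limUnder_eq
  rw [heq]
  refine ⟨fun x _ => ⟨hlim x, (hν.recipMass_ne_top hfin _).lt_top⟩, Continuous.continuousOn ?_⟩
  refine continuous_iff_continuousAt.2 fun x => ?_
  exact ContinuousAt.comp (g := Berman.recipMass (Berman.exponentMeasure P W))
    (hν.continuousAt_recipMass hfin (hne ENNReal.ofReal_ne_top))
    ENNReal.continuous_ofReal.continuousAt
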